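/- **Proposition (In-Cell Regret).** For every dimension $d\ge 1$ there are constants $c_d, c'_d$, depending only on $d$, such that the following holds. Let $L\ge 0$, $h>0$, and let $C\subset\mathbb R^d$ be an axis-parallel cell of side $h$ (a hypercube of side $h$; more generally a box with side lengths in $(0,h]$, containing any part of its boundary). Then there is a (possibly randomized) single-player bandit algorithm with action space $C$, which may depend on $d,L,h,C$ but not on the horizon, such that for every mean-reward function $\mu:C\to[0,1]$ with $|\mu(x)-\mu(y)|\le L\|x-y\|_2$ for all $x,y\in C$, and every reward model in which playing $x\in C$ yields, independently of the past, a reward drawn from a distribution $\nu_x$ with mean $\mu(x)$ and $1$-sub-Gaussian noise ($\int e^{s(y-\mu(x))}\,d\nu_x(y)\le e^{s^2/2}$ for all $s\in\mathbb R$; in particular for rewards in $[0,1]$), and for every number of rounds $T'$, the rewards $r_1,\dots,r_{T'}$ have integrable sum and $$ \mathbb E\big[R_{\mathrm{in}}^{(C)}(T')\big]\;:=\;T'\sup_{x\in C}\mu(x)-\mathbb E\Big[\sum_{t=1}^{T'} r_t\Big]\;\le\; c_d\,(Lh)^{\frac{d}{d+2}}\,(T')^{\frac{d+1}{d+2}}+c'_d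 . $$ -/

import Mathlib

open MeasureTheory ProbabilityTheory

namespace LipschitzBandit

noncomputable section

/-- `C` is an axis-parallel cell of side `h` in `ℝ^d`: a box whose sides have positive length at
most `h` (so cubes of side `h`, and also the truncated cells at the boundary of a partition).
The box may be closed, open or half-open: any part of its boundary may belong to `C`. -/
def IsCell (d : ℕ) (h : ℝ) (C : Set (EuclideanSpace ℝ (Fin d))) : Prop :=
  ∃ a b : Fin d → ℝ, (∀ i, a i < b i ∧ b i - a i ≤ h) ∧
    {x | ∀ i, a i < x i ∧ x i < b i} ⊆ C ∧ C ⊆ {x | ∀ i, a i ≤ x i ∧ x i ≤ b i}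

/-- A (possibly randomized) single-player bandit algorithm with action space `A` and real rewards.
`first` is the law of the first action; `next n` is the law of the action in round `n + 1`
given the actions and observed rewards of rounds `0, …, n`. -/
structure Policy (A : Type*) [MeasurableSpace A] where
  first : Measure A
  isProbabilityMeasure_first : IsProbabilityMeasure first
  next : (n : ℕ) → Kernel (Finset.Iic n → A × ℝ) A
  isMarkovKernel_next : ∀ n, IsMarkovKernel (next n)

attribute [instance] Policy.isProbabilityMeasure_first Policy.isMarkovKernel_next

/-- The law of the sequence (action, reward) over all rounds `0, 1, 2, …` when the algorithm `π`
is run and the reward of action `x` is, independently of the past, drawn from `ν x`. -/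
def runLaw {A : Type*} [MeasurableSpace A] (π : Policy A) (ν : Kernel A ℝ) [IsMarkovKernel ν] :
    Measure (ℕ → A × ℝ) :=
  Kernel.trajMeasure (X := fun _ => A × ℝ) (π.first ⊗ₘ ν)
    (fun n => π.next n ⊗ₖ Kernel.prodMkLeft (Finset.Iic n → A × ℝ) ν)

/-- The reward collected in the first `T` rounds. -/
def totalReward {A : Type*} (T : ℕ) (ω : ℕ → A × ℝ) : ℝ :=
  ∑ t ∈ Finset.range T, (ω t).2

/-- The expected regret over `T` rounds: `T` times the supremum of the mean reward `μ`, minus the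
expected total reward. -/
def expectedRegret {A : Type*} [MeasurableSpace A] (π : Policy A) (ν : Kernel A ℝ)
    [IsMarkovKernel ν] (μ : A → ℝ) (T : ℕ) : ℝ :=
  T * (⨆ x, μ x) - ∫ ω, totalReward T ω ∂(runLaw π ν)

/-- `μ` is a mean-reward function on the cell `C`: it takes values in `[0,1]` and is `L`-Lipschitz
for the Euclidean norm. -/
structure IsMeanReward {d : ℕ} (L : ℝ) (C : Set (EuclideanSpace ℝ (Fin d))) (μ : C → ℝ) :
    Prop where
  mem_Icc : ∀ x, μ x ∈ Set.Icc (0 : ℝ) 1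
  lipschitz : ∀ x y : C,
    |μ x - μ y| ≤ L * ‖(x : EuclideanSpace ℝ (Fin d)) - (y : EuclideanSpace ℝ (Fin d))‖

/-- The rewards have mean `μ` and `1`-sub-Gaussian noise. -/
structure IsRewardKernel {A : Type*} [MeasurableSpace A] (μ : A → ℝ) (ν : Kernel A ℝ) :
    Prop where
  mean : ∀ x, ∫ y, y ∂(ν x) = μ x
  subgaussian : ∀ x, HasSubgaussianMGF (fun y => y - μ x) 1 (ν x)

end

end LipschitzBandit

/-! Time is cut into epochs of length `N = 2 ^ e`, and each epoch plays only finitely many points of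
the cell. Put `M = L * h`. A grid with `u` points per axis costs about `N * M / u` in
discretization, and bandit play on `K = u ^ d` arms costs about `√(K * N)`. Balancing the two
(`exists_balanced_scale`) gives `M ^ (d / (d + 2)) * N ^ ((d + 1) / (d + 2))`. These bounds grow
geometrically in `e`, so they sum to the order of the last one (`sum_le_of_epoch_bounds`). Since
each epoch starts afresh, no horizon is needed.

The exponent leaves no room for a logarithm, so the finite-armed algorithm must have regret `O(√(K *
N))`. Here it is regularized play with the `1/2`-Tsallis entropy. For estimated gains `G` the
potential is the minimum over `l` of `l + η⁻² ∑ 1 / (l - G i)`, with `η = 1 / √N`. Its gradient is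
the weight vector, it dominates every `G i`, and at `G = 0` it is at most `2 * √(K * N)`. Hence the
gain of any fixed arm is at most the initial potential plus the sum of the second-order increments
(`potential_step`, `sum_roundGain_le`).

Sub-Gaussian rewards are unbounded, whereas `potential_step` needs the estimated gain to be at most
half of `l - G x`. Let `r = √(K / N)`. Rewards are clipped from above at `B` of order `r ^ (-1/2)`,
and uniform exploration of mass `r / 2` is mixed in. By AM-GM this secures the requirement
(`two_mul_clipLevel_le`). Clipping bias, exploration and the second-order term each cost `O(r)` per
round (`le_integral_roundGain`), hence `O(√(K * N))` per epoch. -/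

namespace LipschitzBandit

noncomputable section

/-! ### Policies driven by a state, and their trajectory law -/

section StatePolicy

variable {A S : Type*} [MeasurableSpace A] [MeasurableSpace S]

/-- The state before round `n` of an algorithm with initial state `s₀` and update rule `upd`. -/
def stateAt (s₀ : S) (upd : ℕ → S × (A × ℝ) → S) : ℕ → (ℕ → A × ℝ) → S
  | 0, _ => s₀
  | n + 1, ω => upd n (stateAt s₀ upd n ω, ω n)

omit [MeasurableSpace A] [MeasurableSpace S] in
lemma stateAt_congr (s₀ : S) (upd : ℕ → S × (A × ℝ) → S) {n : ℕ} {ω ω' : ℕ → A × ℝ}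
    (h : ∀ i < n, ω i = ω' i) : stateAt s₀ upd n ω = stateAt s₀ upd n ω' := by
  induction n with
  | zero => rfl
  | succ n ih => rw [stateAt, stateAt, ih fun i hi => h i (by omega), h n (by omega)]

lemma measurable_stateAt (s₀ : S) {upd : ℕ → S × (A × ℝ) → S} (hupd : ∀ n, Measurable (upd n))
    (n : ℕ) : Measurable (stateAt s₀ upd n) := by
  induction n with
  | zero => exact measurable_const
  | succ n ih => exact (hupd n).comp (ih.prodMk (measurable_pi_apply n))

/-- Extend a finite history to an infinite one by repeating its first entry. -/
def extendHistory (n : ℕ) (x : Finset.Iic n → A × ℝ) (i : ℕ) : A × ℝ :=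
  if h : i ∈ Finset.Iic n then x ⟨i, h⟩ else x ⟨0, by simp⟩

lemma measurable_extendHistory (n : ℕ) : Measurable (extendHistory (A := A) n) := by
  refine measurable_pi_lambda _ fun i => ?_
  unfold extendHistory
  split_ifs <;> exact measurable_pi_apply _

/-- The policy that plays from `act n s` in round `n` when its state is `s`. -/
def statePolicy (s₀ : S) (act : ℕ → Kernel S A) [∀ n, IsMarkovKernel (act n)]
    (upd : ℕ → S × (A × ℝ) → S) (hupd : ∀ n, Measurable (upd n)) : Policy A where
  first := act 0 s₀
  isProbabilityMeasure_first := inferInstance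
  next n := (act (n + 1)).comap (fun x => stateAt s₀ upd (n + 1) (extendHistory n x))
    ((measurable_stateAt s₀ hupd _).comp (measurable_extendHistory n))
  isMarkovKernel_next _ := inferInstance

instance (π : Policy A) (ν : Kernel A ℝ) [IsMarkovKernel ν] :
    IsProbabilityMeasure (runLaw π ν) := by
  unfold runLaw; infer_instance

lemma map_runLaw_zero (π : Policy A) (ν : Kernel A ℝ) [IsMarkovKernel ν] :
    (runLaw π ν).map (fun ω => ω 0) = π.first ⊗ₘ ν := by
  have h : (fun ω : ℕ → A × ℝ => ω 0) =
      (fun x : Finset.Iic 0 → A × ℝ => x ⟨0, by simp⟩) ∘ Preorder.frestrictLe 0 := rfl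
  rw [h, ← Measure.map_map (by fun_prop) (by fun_prop), runLaw, Kernel.trajMeasure,
    Measure.map_comp _ _ (by fun_prop), Kernel.traj_map_frestrictLe,
    Kernel.partialTraj_self, Measure.id_comp, Measure.map_map (by fun_prop) (by fun_prop)]
  exact Measure.map_id

variable (s₀ : S) (act : ℕ → Kernel S A) [∀ n, IsMarkovKernel (act n)]
    (upd : ℕ → S × (A × ℝ) → S) (hupd : ∀ n, Measurable (upd n))
    (ν : Kernel A ℝ) [IsMarkovKernel ν]

/-- The joint law of the state, the action and the reward in round `n`. -/
lemma map_runLaw_statePolicy (n : ℕ) :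
    (runLaw (statePolicy s₀ act upd hupd) ν).map (fun ω => (stateAt s₀ upd n ω, ω n)) =
      (runLaw (statePolicy s₀ act upd hupd) ν).map (stateAt s₀ upd n) ⊗ₘ
        (act n ⊗ₖ Kernel.prodMkLeft S ν) := by
  set P := runLaw (statePolicy s₀ act upd hupd) ν with hP
  cases n with
  | zero =>
    have h0 : P.map (stateAt s₀ upd 0) = Measure.dirac s₀ := by
      change P.map (fun _ => s₀) = _
      simp
    have h1 : (fun ω : ℕ → A × ℝ => (stateAt s₀ upd 0 ω, ω 0)) =
      (fun z => (s₀, z)) ∘ (fun ω => ω 0) := rfl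
    rw [h0, h1, ← Measure.map_map (by fun_prop) (by fun_prop), map_runLaw_zero]
    ext t ht
    rw [Measure.map_apply (by fun_prop) ht, Measure.compProd_apply ht,
      lintegral_dirac' _ (Kernel.measurable_kernel_prodMk_left ht),
      Kernel.compProd_apply (by exact measurable_prodMk_left ht), Measure.compProd_apply
        (by exact measurable_prodMk_left ht)]
    rfl
  | succ n =>
    have hm : Measurable (fun x => stateAt s₀ upd (n + 1) (extendHistory (A := A) n x)) :=
      (measurable_stateAt s₀ hupd _).comp (measurable_extendHistory n)
    -- The state before round `n + 1` depends only on rounds `0, …, n`, so the filler values of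
    -- `extendHistory` are irrelevant.
    have hst : stateAt s₀ upd (n + 1) =
        (fun x => stateAt s₀ upd (n + 1) (extendHistory n x)) ∘ Preorder.frestrictLe n := by
      funext ω
      refine stateAt_congr _ _ fun i hi => ?_
      have : i ∈ Finset.Iic n := by simp; omega
      simp [extendHistory, Nat.le_of_lt_succ hi]
    have key := Kernel.map_frestrictLe_trajMeasure_compProd_eq_map_trajMeasure
      (X := fun _ => A × ℝ) (μ₀ := (statePolicy s₀ act upd hupd).first ⊗ₘ ν)
      (κ := fun n => (statePolicy s₀ act upd hupd).next n ⊗ₖ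
        Kernel.prodMkLeft (Finset.Iic n → A × ℝ) ν) (a := n)
    change P.map (Preorder.frestrictLe n) ⊗ₘ _ = P.map _ at key
    have h1 : (fun ω : ℕ → A × ℝ => (stateAt s₀ upd (n + 1) ω, ω (n + 1))) =
        (Prod.map (fun x => stateAt s₀ upd (n + 1) (extendHistory n x)) id) ∘
          (fun ω => (Preorder.frestrictLe n ω, ω (n + 1))) := by
      funext ω
      exact Prod.ext (congrFun hst ω) rfl
    rw [h1, ← Measure.map_map (hm.prodMap measurable_id) (by fun_prop), ← key]
    conv_rhs => rw [hst, ← Measure.map_map hm (by fun_prop)]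
    ext t ht
    rw [Measure.map_apply (hm.prodMap measurable_id) ht,
      Measure.compProd_apply ((hm.prodMap measurable_id) ht), Measure.compProd_apply ht,
      lintegral_map (Kernel.measurable_kernel_prodMk_left ht) hm]
    refine lintegral_congr fun x => ?_
    have hx := measurable_prodMk_left (x := stateAt s₀ upd (n + 1) (extendHistory n x)) ht
    rw [Kernel.compProd_apply hx, Kernel.compProd_apply (by exact hx)]
    rfl

/-- A pointwise-in-the-state bound on the conditional mean of a function of (state, action, reward)
holds in expectation. -/
lemma integrable_and_le_integral_round (n : ℕ) {f : S × (A × ℝ) → ℝ} (hf : Measurable f)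
    {b : ENNReal} (hb : b ≠ ⊤)
    (hfb : ∀ s, ∫⁻ x, ∫⁻ y, ‖f (s, (x, y))‖ₑ ∂(ν x) ∂(act n s) ≤ b)
    {c : ℝ} (hc : ∀ s, c ≤ ∫ x, ∫ y, f (s, (x, y)) ∂(ν x) ∂(act n s)) :
    Integrable (fun ω => f (stateAt s₀ upd n ω, ω n))
      (runLaw (statePolicy s₀ act upd hupd) ν) ∧
    c ≤ ∫ ω, f (stateAt s₀ upd n ω, ω n) ∂(runLaw (statePolicy s₀ act upd hupd) ν) := by
  set P := runLaw (statePolicy s₀ act upd hupd) ν with hP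
  have hst := measurable_stateAt (A := A) s₀ hupd n
  have hm : Measurable (fun ω : ℕ → A × ℝ => (stateAt s₀ upd n ω, ω n)) :=
    hst.prodMk (measurable_pi_apply n)
  have hlaw := map_runLaw_statePolicy s₀ act upd hupd ν n
  rw [← hP] at hlaw
  have hQ : IsProbabilityMeasure (P.map (stateAt s₀ upd n)) :=
    Measure.isProbabilityMeasure_map hst.aemeasurable
  -- The `L¹` bound is uniform in the state, so integrability needs no information on the law of the
  -- state.
  have hin : ∀ s, ∫⁻ z, ‖f (s, z)‖ₑ ∂((act n ⊗ₖ Kernel.prodMkLeft S ν) s) ≤ b := by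
    intro s
    rw [Kernel.lintegral_compProd _ _ _ (by fun_prop)]
    exact hfb s
  have hint : Integrable f (P.map (fun ω => (stateAt s₀ upd n ω, ω n))) := by
    rw [hlaw]
    refine ⟨hf.aestronglyMeasurable, ?_⟩
    rw [HasFiniteIntegral, Measure.lintegral_compProd (by fun_prop)]
    refine lt_of_le_of_lt (lintegral_mono hin) ?_
    simpa using lt_top_iff_ne_top.2 hb
  refine ⟨hint.comp_measurable hm, ?_⟩
  have h2 : ∫ ω, f (stateAt s₀ upd n ω, ω n) ∂P =
      ∫ z, f z ∂(P.map (fun ω => (stateAt s₀ upd n ω, ω n))) :=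
    (integral_map hm.aemeasurable hf.aestronglyMeasurable).symm
  rw [h2, hlaw]
  rw [hlaw] at hint
  rw [Measure.integral_compProd hint]
  have h3 : c = ∫ _s, c ∂(P.map (stateAt s₀ upd n)) := by simp
  rw [h3]
  have hmarg : Integrable (fun s => ∫ z, f (s, z) ∂((act n ⊗ₖ Kernel.prodMkLeft S ν) s))
      (P.map (stateAt s₀ upd n)) :=
    Integrable.integral_compProd (κ := Kernel.const Unit _) (a := ()) hint
  refine integral_mono (integrable_const _) hmarg fun s => ?_
  have hs : Integrable (fun z => f (s, z)) ((act n ⊗ₖ Kernel.prodMkLeft S ν) s) :=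
    ⟨(hf.comp measurable_prodMk_left).aestronglyMeasurable, lt_of_le_of_lt (hin s) hb.lt_top⟩
  simp only
  rw [integral_compProd hs]
  exact hc s

end StatePolicy

/-! ### The Tsallis potential and its weights -/

section Potential

variable {α : Type*}

/-- Intermediate value theorem: at `max G + 1 / η` the largest gain alone contributes `η ^ 2`, while
at `max G + √K / η` each of the `K` terms is at most `η ^ 2 / K`. -/
lemma exists_level {s : Finset α} (hs : s.Nonempty) {η : ℝ} (hη : 0 < η) (G : α → ℝ) :
    ∃ l, (∀ i ∈ s, G i < l) ∧ ∑ i ∈ s, 1 / (l - G i) ^ 2 = η ^ 2 := by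
  obtain ⟨i₀, hi₀, hmax⟩ := s.exists_max_image G hs
  set K : ℝ := (s.card : ℝ) with hK
  have hK1 : 1 ≤ K := Nat.one_le_cast.2 hs.card_pos
  have hsq : 1 ≤ √K := Real.one_le_sqrt.2 hK1
  set a := G i₀ + 1 / η with ha
  set b := G i₀ + √K / η with hb
  have hη' : 0 < 1 / η := by positivity
  have hab : a ≤ b := by
    rw [ha, hb]; gcongr
  have hlt : ∀ l, a ≤ l → ∀ i ∈ s, G i < l := fun l hl i hi => by
    linarith [hmax i hi]
  have hcont : ContinuousOn (fun l => ∑ i ∈ s, 1 / (l - G i) ^ 2) (Set.Icc a b) := by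
    refine continuousOn_finsetSum _ fun i hi => ?_
    refine continuousOn_const.div (by fun_prop) fun l hl => ?_
    have := hlt l hl.1 i hi
    exact pow_ne_zero _ (by linarith)
  have hfa : η ^ 2 ≤ ∑ i ∈ s, 1 / (a - G i) ^ 2 := by
    have h1 : 1 / (a - G i₀) ^ 2 = η ^ 2 := by
      rw [ha]; field_simp; ring
    rw [← h1]
    exact Finset.single_le_sum (f := fun i => 1 / (a - G i) ^ 2) (fun i _ => by positivity) hi₀
  have hfb : ∑ i ∈ s, 1 / (b - G i) ^ 2 ≤ η ^ 2 := by
    have h1 : ∀ i ∈ s, 1 / (b - G i) ^ 2 ≤ η ^ 2 / K := fun i hi => by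
      have h2 : √K / η ≤ b - G i := by linarith [hmax i hi]
      have h3 : 0 < √K / η := by positivity
      calc 1 / (b - G i) ^ 2 ≤ 1 / (√K / η) ^ 2 := by gcongr
        _ = η ^ 2 / K := by
          rw [div_pow, Real.sq_sqrt (by linarith), one_div_div]
    calc _ ≤ ∑ i ∈ s, η ^ 2 / K := Finset.sum_le_sum h1
      _ = η ^ 2 := by rw [Finset.sum_const, nsmul_eq_mul, ← hK]; field_simp
  obtain ⟨l, hl, hl'⟩ := intermediate_value_Icc' hab hcont ⟨hfb, hfa⟩
  exact ⟨l, hlt l hl.1, hl'⟩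

open Classical in
/-- The normalization level `l` at which the weights `1 / (η * (l - G i)) ^ 2` sum to one. -/
def level (s : Finset α) (η : ℝ) (G : α → ℝ) : ℝ :=
  if h : ∃ l, (∀ i ∈ s, G i < l) ∧ ∑ i ∈ s, 1 / (l - G i) ^ 2 = η ^ 2 then h.choose else 0

/-- The weight of `i` in the Tsallis-entropy regularized maximizer of the gains `G`. -/
def weight (s : Finset α) (η : ℝ) (G : α → ℝ) (i : α) : ℝ :=
  1 / (η * (level s η G - G i)) ^ 2

/-- The dual potential of the `1/2`-Tsallis entropy. -/
def potential (s : Finset α) (η l : ℝ) (G : α → ℝ) : ℝ :=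
  l + 1 / η ^ 2 * ∑ i ∈ s, 1 / (l - G i)

variable {s : Finset α} {η : ℝ}

lemma lt_level (hs : s.Nonempty) (hη : 0 < η) (G : α → ℝ) {i : α} (hi : i ∈ s) :
    G i < level s η G := by
  rw [level, dif_pos (exists_level hs hη G)]
  exact (exists_level hs hη G).choose_spec.1 i hi

lemma sum_level (hs : s.Nonempty) (hη : 0 < η) (G : α → ℝ) :
    ∑ i ∈ s, 1 / (level s η G - G i) ^ 2 = η ^ 2 := by
  rw [level, dif_pos (exists_level hs hη G)]
  exact (exists_level hs hη G).choose_spec.2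

/-- The sum defining the level is strictly decreasing above the largest gain. This describes
sublevel sets without the choice in `level`, which is how measurability is obtained. -/
lemma level_lt_iff (hs : s.Nonempty) (hη : 0 < η) (G : α → ℝ) (a : ℝ) :
    level s η G < a ↔ (∀ i ∈ s, G i < a) ∧ ∑ i ∈ s, 1 / (a - G i) ^ 2 < η ^ 2 := by
  constructor
  · intro h
    refine ⟨fun i hi => (lt_level hs hη G hi).trans h, ?_⟩
    rw [← sum_level hs hη G]
    refine Finset.sum_lt_sum_of_nonempty hs fun i hi => ?_
    have := lt_level hs hη G hi
    have h0 : 0 < level s η G - G i := by linarith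
    gcongr
  · rintro ⟨h1, h2⟩
    by_contra! h
    refine absurd h2 (not_lt.2 ?_)
    rw [← sum_level hs hη G]
    refine Finset.sum_le_sum fun i hi => ?_
    have h0 : 0 < a - G i := by linarith [h1 i hi]
    gcongr

lemma measurable_level (hs : s.Nonempty) (hη : 0 < η) :
    Measurable (level s η : (α → ℝ) → ℝ) := by
  refine measurable_of_Iio fun a => ?_
  have : level s η ⁻¹' Set.Iio a = (⋂ i ∈ s, {G : α → ℝ | G i < a}) ∩
      {G : α → ℝ | ∑ i ∈ s, 1 / (a - G i) ^ 2 < η ^ 2} := by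
    ext G
    simp [level_lt_iff hs hη]
  rw [this]
  refine MeasurableSet.inter (Finset.measurableSet_biInter _ fun i _ =>
    measurableSet_lt (by fun_prop) measurable_const) ?_
  exact measurableSet_lt (Finset.measurable_fun_sum _ fun i _ => by fun_prop) measurable_const

lemma measurable_weight (hs : s.Nonempty) (hη : 0 < η) (i : α) :
    Measurable (fun G : α → ℝ => weight s η G i) := by
  have := measurable_level (α := α) hs hη
  unfold weight
  fun_prop

lemma weight_nonneg (G : α → ℝ) (i : α) : 0 ≤ weight s η G i := by
  unfold weight; positivity

lemma sum_weight (hs : s.Nonempty) (hη : 0 < η) (G : α → ℝ) : ∑ i ∈ s, weight s η G i = 1 := by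
  have h : ∀ i, weight s η G i = 1 / η ^ 2 * (1 / (level s η G - G i) ^ 2) := fun i => by
    rw [weight, mul_pow]; field_simp
  simp_rw [h]
  rw [← Finset.mul_sum, sum_level hs hη]
  field_simp

/-- Cauchy–Schwarz against the normalization. This sum controls the second-order cost of a round,
and the bound is what avoids a logarithm. -/
lemma sum_inv_level_sub_le (hs : s.Nonempty) (hη : 0 < η) (G : α → ℝ) :
    ∑ i ∈ s, 1 / (level s η G - G i) ≤ √s.card * η := by
  have h := sum_level hs hη G
  have h2 := sq_sum_le_card_mul_sum_sq (s := s) (f := fun i => 1 / (level s η G - G i))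
  simp only [div_pow, one_pow] at h2
  rw [h] at h2
  refine abs_le_of_sq_le_sq' ?_ (by positivity) |>.2
  rw [mul_pow, Real.sq_sqrt (by positivity)]
  exact h2

/-- The potential is convex in `l`, and the normalization says its derivative vanishes at `level`.
The proof sums the tangent-line inequalities for `1 / (l - G i)`. -/
lemma potential_level_le (hs : s.Nonempty) (hη : 0 < η) (G : α → ℝ) {l : ℝ}
    (hl : ∀ i ∈ s, G i < l) : potential s η (level s η G) G ≤ potential s η l G := by
  have h : ∑ i ∈ s, (1 / (level s η G - G i) - (l - level s η G) * (1 / (level s η G - G i) ^ 2))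
      ≤ ∑ i ∈ s, 1 / (l - G i) := by
    refine Finset.sum_le_sum fun i hi => ?_
    have ha : 0 < level s η G - G i := sub_pos.2 (lt_level hs hη G hi)
    have hb : 0 < l - G i := sub_pos.2 (hl i hi)
    have hd : l - level s η G = (l - G i) - (level s η G - G i) := by ring
    rw [hd]
    generalize level s η G - G i = a at *
    generalize l - G i = b at *
    rw [← sub_nonneg]
    have : 1 / b - (1 / a - (b - a) * (1 / a ^ 2)) = (b - a) ^ 2 / (a ^ 2 * b) := by
      field_simp; ring
    rw [this]; positivity
  rw [Finset.sum_sub_distrib, ← Finset.mul_sum, sum_level hs hη] at h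
  have h2 := mul_le_mul_of_nonneg_left h (show (0 : ℝ) ≤ 1 / η ^ 2 by positivity)
  unfold potential
  have h3 : 1 / η ^ 2 * (∑ i ∈ s, 1 / (level s η G - G i) - (l - level s η G) * η ^ 2) =
      1 / η ^ 2 * ∑ i ∈ s, 1 / (level s η G - G i) - (l - level s η G) := by
    field_simp
  linarith

lemma potential_level_zero_le (hs : s.Nonempty) (hη : 0 < η) :
    potential s η (level s η 0) 0 ≤ 2 * √s.card / η := by
  have hK : (0 : ℝ) < s.card := by exact_mod_cast hs.card_pos
  have hq : 0 < √(s.card : ℝ) := Real.sqrt_pos.2 hK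
  refine (potential_level_le hs hη 0 (l := √s.card / η) fun i _ => by simp; positivity).trans ?_
  refine le_of_eq ?_
  simp only [potential, Pi.zero_apply, sub_zero, Finset.sum_const, nsmul_eq_mul]
  have h := Real.mul_self_sqrt hK.le
  generalize √(s.card : ℝ) = q at *
  rw [← h]
  field_simp
  ring

lemma le_potential_level (hs : s.Nonempty) (hη : 0 < η) (G : α → ℝ) {i : α} (hi : i ∈ s) :
    G i ≤ potential s η (level s η G) G := by
  have h : 0 ≤ ∑ j ∈ s, 1 / (level s η G - G j) := Finset.sum_nonneg fun j hj =>
    one_div_nonneg.2 (sub_nonneg.2 (lt_level hs hη G hj).le)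
  have := lt_level hs hη G hi
  unfold potential
  have : 0 ≤ 1 / η ^ 2 * ∑ j ∈ s, 1 / (level s η G - G j) := by positivity
  linarith

/-- The change of the potential when the gain of one action changes by `g`. -/
lemma potential_step (hs : s.Nonempty) (hη : 0 < η) {G G' : α → ℝ} {x : α} (hx : x ∈ s) {g : ℝ}
    (hg : 2 * g ≤ level s η G - G x) (hGx : G' x = G x + g) (hG : ∀ i, i ≠ x → G' i = G i) :
    potential s η (level s η G') G' ≤ potential s η (level s η G) G + weight s η G x * g +
      2 * weight s η G x * g ^ 2 / (level s η G - G x) := by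
  classical
  have hw : 0 < level s η G - G x := sub_pos.2 (lt_level hs hη G hx)
  -- The new level need not be computed: by minimality, the old level gives an upper bound.
  have h1 : potential s η (level s η G') G' ≤ potential s η (level s η G) G' := by
    refine potential_level_le hs hη G' fun i hi => ?_
    by_cases hix : i = x
    · subst hix; linarith
    · rw [hG i hix]; exact lt_level hs hη G hi
  refine h1.trans ?_
  unfold potential weight
  rw [← Finset.add_sum_erase s _ hx, ← Finset.add_sum_erase s (fun i => 1 / (_ - G i)) hx,
    Finset.sum_congr rfl fun i hi => by rw [hG i (Finset.ne_of_mem_erase hi)], hGx]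
  rw [show level s η G - (G x + g) = level s η G - G x - g by ring]
  generalize ∑ i ∈ s.erase x, 1 / (level s η G - G i) = R
  generalize level s η G = l at *
  generalize l - G x = w at *
  have hwg : 0 < w - g := by linarith
  rw [← sub_nonneg]
  -- The exact remainder of the expansion of `1 / (w - g)`. It is nonnegative for `2 * g ≤ w`, so
  -- negative `g` of any size is allowed; hence clipping from above suffices.
  have : l + 1 / η ^ 2 * (1 / w + R) + 1 / (η * w) ^ 2 * g + 2 * (1 / (η * w) ^ 2) * g ^ 2 / w -
      (l + 1 / η ^ 2 * (1 / (w - g) + R)) = g ^ 2 * (w - 2 * g) / (η ^ 2 * w ^ 3 * (w - g)) := by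
    field_simp; ring
  rw [this]
  have : 0 ≤ w - 2 * g := by linarith
  positivity

end Potential

/-! ### Moments and clipping of sub-Gaussian rewards -/

section Moments

variable {P : Measure ℝ} {m : ℝ}

lemma integrable_exp_of_subgaussian (hP : HasSubgaussianMGF (fun y => y - m) 1 P) (t : ℝ) :
    Integrable (fun y => Real.exp (t * y)) P := by
  refine ((hP.integrable_exp_mul t).const_mul (Real.exp (t * m))).congr (ae_of_all _ fun y => ?_)
  simp only
  rw [← Real.exp_add]; congr 1; ring

lemma integral_exp_le_of_subgaussian (hP : HasSubgaussianMGF (fun y => y - m) 1 P) (t : ℝ) :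
    ∫ y, Real.exp (t * y) ∂P ≤ Real.exp (t * m + t ^ 2 / 2) := by
  have h := hP.mgf_le t
  have h2 : ∫ y, Real.exp (t * y) ∂P = Real.exp (t * m) * mgf (fun y => y - m) P t := by
    rw [mgf, ← integral_const_mul]
    refine integral_congr_ae (ae_of_all _ fun y => ?_)
    simp only
    rw [← Real.exp_add]; congr 1; ring
  rw [h2, Real.exp_add]
  gcongr
  simpa using h

lemma sq_le_two_mul_exp_add (y : ℝ) : y ^ 2 ≤ 2 * (Real.exp (1 * y) + Real.exp (-1 * y)) := by
  rw [one_mul, neg_one_mul]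
  have h1 := Real.exp_pos y
  have h2 := Real.exp_pos (-y)
  rcases le_total 0 y with h | h
  · nlinarith [Real.quadratic_le_exp_of_nonneg h]
  · nlinarith [Real.quadratic_le_exp_of_nonneg (neg_nonneg.2 h)]

lemma integrable_sq_of_subgaussian (hP : HasSubgaussianMGF (fun y => y - m) 1 P) :
    Integrable (fun y => y ^ 2) P := by
  refine (((integrable_exp_of_subgaussian hP 1).add
    (integrable_exp_of_subgaussian hP (-1))).const_mul 2).mono' (by fun_prop)
    (ae_of_all _ fun y => ?_)
  rw [Real.norm_of_nonneg (sq_nonneg y)]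
  exact sq_le_two_mul_exp_add y

lemma integral_sq_le_of_subgaussian (hP : HasSubgaussianMGF (fun y => y - m) 1 P)
    (hm : m ∈ Set.Icc (0 : ℝ) 1) : ∫ y, y ^ 2 ∂P ≤ 4 * Real.exp (3 / 2) := by
  have h1 := integrable_exp_of_subgaussian hP 1
  have h2 := integrable_exp_of_subgaussian hP (-1)
  have h3 : ∫ y, y ^ 2 ∂P ≤ ∫ y, 2 * (Real.exp (1 * y) + Real.exp (-1 * y)) ∂P :=
    integral_mono (integrable_sq_of_subgaussian hP) ((h1.add h2).const_mul 2)
      sq_le_two_mul_exp_add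
  rw [integral_const_mul, integral_add h1 h2] at h3
  have h4 := integral_exp_le_of_subgaussian hP 1
  have h5 := integral_exp_le_of_subgaussian hP (-1)
  have h6 : Real.exp (1 * m + 1 ^ 2 / 2) ≤ Real.exp (3 / 2) :=
    Real.exp_le_exp.2 (by linarith [hm.2])
  have h7 : Real.exp (-1 * m + (-1) ^ 2 / 2) ≤ Real.exp (3 / 2) :=
    Real.exp_le_exp.2 (by linarith [hm.1])
  linarith

lemma min_sq_le {y B : ℝ} (hB : 0 ≤ B) : (min y B) ^ 2 ≤ y ^ 2 := by
  rcases le_total y B with h | h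
  · rw [min_eq_left h]
  · rw [min_eq_right h]; gcongr

lemma integrable_min_sq_of_subgaussian (hP : HasSubgaussianMGF (fun y => y - m) 1 P) {B : ℝ}
    (hB : 0 ≤ B) : Integrable (fun y => (min y B) ^ 2) P := by
  refine (integrable_sq_of_subgaussian hP).mono' (by fun_prop) (ae_of_all _ fun y => ?_)
  rw [Real.norm_of_nonneg (sq_nonneg _)]
  exact min_sq_le hB

variable [IsProbabilityMeasure P]

lemma integrable_id_of_subgaussian (hP : HasSubgaussianMGF (fun y => y - m) 1 P) :
    Integrable (fun y => y) P := by
  refine ((integrable_const (1 : ℝ)).add (integrable_sq_of_subgaussian hP)).mono' (by fun_prop)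
    (ae_of_all _ fun y => ?_)
  simp only [Pi.add_apply, Real.norm_eq_abs]
  nlinarith [sq_abs y, sq_nonneg (|y| - 1)]

lemma integrable_min_of_subgaussian (hP : HasSubgaussianMGF (fun y => y - m) 1 P) (B : ℝ) :
    Integrable (fun y => min y B) P :=
  (integrable_id_of_subgaussian hP).inf (integrable_const B)

/-- Clipping at a positive level `B` changes the mean by `O(1 / B ^ 2)`. -/
lemma sub_le_integral_min_of_subgaussian (hP : HasSubgaussianMGF (fun y => y - m) 1 P)
    (hm : m ∈ Set.Icc (0 : ℝ) 1) (hmean : ∫ y, y ∂P = m) {B : ℝ} (hB : 0 < B) :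
    m - 2 * Real.exp (3 / 2) / B ^ 2 ≤ ∫ y, min y B ∂P := by
  have h1 := integrable_exp_of_subgaussian hP 1
  -- The loss `max 0 (y - B)` from clipping is at most `exp (y - B)`, whose mean the sub-Gaussian
  -- bound controls.
  have hle : ∀ y, y - Real.exp (-B) * Real.exp (1 * y) ≤ min y B := fun y => by
    rw [← Real.exp_add]
    refine le_min (by linarith [Real.exp_pos (-B + 1 * y)]) ?_
    linarith [Real.add_one_le_exp (-B + 1 * y)]
  have h2 := integral_mono ((integrable_id_of_subgaussian hP).sub (h1.const_mul (Real.exp (-B))))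
    (integrable_min_of_subgaussian hP B) hle
  simp only [Pi.sub_apply] at h2
  rw [integral_sub (integrable_id_of_subgaussian hP) (h1.const_mul _), integral_const_mul,
    hmean] at h2
  have h3 : ∫ y, Real.exp (1 * y) ∂P ≤ Real.exp (3 / 2) :=
    (integral_exp_le_of_subgaussian hP 1).trans (Real.exp_le_exp.2 (by linarith [hm.2]))
  have h4 : Real.exp (-B) ≤ 2 / B ^ 2 := by
    rw [Real.exp_neg, inv_le_comm₀ (Real.exp_pos _) (by positivity), inv_div]
    linarith [Real.quadratic_le_exp_of_nonneg hB.le]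
  have h5 : Real.exp (-B) * ∫ y, Real.exp (1 * y) ∂P ≤ 2 / B ^ 2 * Real.exp (3 / 2) := by
    gcongr
  rw [show 2 * Real.exp (3 / 2) / B ^ 2 = 2 / B ^ 2 * Real.exp (3 / 2) by ring]
  linarith

end Moments

/-! ### Exploration and the clipping level -/

section Sampling

variable {A : Type*}

/-- The relative exploration scale `√(K / N)` for `K` actions and `N` rounds. -/
def rate (s : Finset A) (N : ℝ) : ℝ := √(s.card / N)

/-- The level at which observed rewards are clipped from above. -/
def clipLevel (s : Finset A) (N : ℝ) : ℝ := √(1 / (2 * rate s N)) / 2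

/-- The probability of playing `i`: the Tsallis weights mixed with uniform exploration. -/
def playProb (s : Finset A) (N : ℝ) (G : A → ℝ) (i : A) : ℝ :=
  (1 - rate s N / 2) * weight s (1 / √N) G i + rate s N / 2 / s.card

variable {s : Finset A} {N : ℝ}

lemma rate_pos (hs : s.Nonempty) (hN : 0 < N) : 0 < rate s N := by
  have : (0 : ℝ) < s.card := by exact_mod_cast hs.card_pos
  unfold rate; positivity

lemma rate_le_one (hN : 0 < N) (hsN : s.card ≤ N) : rate s N ≤ 1 :=
  Real.sqrt_le_one.2 ((div_le_one hN).2 hsN)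

lemma clipLevel_pos (hs : s.Nonempty) (hN : 0 < N) : 0 < clipLevel s N := by
  have := rate_pos hs hN
  unfold clipLevel; positivity

lemma clipLevel_sq (hs : s.Nonempty) (hN : 0 < N) :
    clipLevel s N ^ 2 = 1 / (8 * rate s N) := by
  have := rate_pos hs hN
  rw [clipLevel, div_pow, Real.sq_sqrt (by positivity)]
  field_simp; norm_num

lemma sum_playProb (hs : s.Nonempty) (hN : 0 < N) (G : A → ℝ) :
    ∑ i ∈ s, playProb s N G i = 1 := by
  have : (s.card : ℝ) ≠ 0 := by exact_mod_cast hs.card_pos.ne'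
  unfold playProb
  rw [Finset.sum_add_distrib, ← Finset.mul_sum, sum_weight hs (by positivity), Finset.sum_const,
    nsmul_eq_mul]
  field_simp; ring

lemma le_playProb (hN : 0 < N) (hsN : s.card ≤ N) (G : A → ℝ) (i : A) :
    rate s N / 2 / s.card ≤ playProb s N G i := by
  have h1 := rate_le_one hN hsN
  have h2 := weight_nonneg (s := s) (η := 1 / √N) G i
  unfold playProb
  nlinarith

lemma playProb_pos (hs : s.Nonempty) (hN : 0 < N) (hsN : s.card ≤ N) (G : A → ℝ) (i : A) :
    0 < playProb s N G i := by
  have : (0 : ℝ) < s.card := by exact_mod_cast hs.card_pos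
  have := rate_pos hs hN
  exact lt_of_lt_of_le (by positivity) (le_playProb hN hsN G i)

lemma weight_le_two_mul_playProb (hs : s.Nonempty) (hN : 0 < N) (hsN : s.card ≤ N) (G : A → ℝ)
    (i : A) : weight s (1 / √N) G i ≤ 2 * playProb s N G i := by
  have h1 := rate_le_one hN hsN
  have h3 := rate_pos hs hN
  have h2 := weight_nonneg (s := s) (η := 1 / √N) G i
  have : 0 ≤ rate s N / 2 / s.card := by positivity
  unfold playProb
  nlinarith

/-- With `w` the gap to the level, playing probability times `w` is at least `a / 2 + b`, where `a =
N / w` comes from the Tsallis weight and `b = r * w / (2 * K)` from exploration. Their product `1 /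
(2 * r)` does not depend on `w`, so AM-GM bounds the sum below; `clipLevel` is chosen with `(2 * B)
^ 2` equal to this product. -/
lemma two_mul_clipLevel_le (hs : s.Nonempty) (hN : 0 < N) (hsN : s.card ≤ N) (G : A → ℝ) {i : A}
    (hi : i ∈ s) :
    2 * clipLevel s N ≤ playProb s N G i * (level s (1 / √N) G - G i) := by
  have hK : (0 : ℝ) < s.card := by exact_mod_cast hs.card_pos
  have hη : 0 < 1 / √N := by positivity
  have hw : 0 < level s (1 / √N) G - G i := sub_pos.2 (lt_level hs hη G hi)
  have h1 := rate_le_one hN hsN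
  have h2 := rate_pos hs hN
  have hr : rate s N ^ 2 = s.card / N := by rw [rate, Real.sq_sqrt (by positivity)]
  refine abs_le_of_sq_le_sq' ?_ (mul_nonneg (playProb_pos hs hN hsN G i).le hw.le) |>.2
  have e5 : (2 * clipLevel s N) ^ 2 = 1 / (2 * rate s N) := by
    rw [mul_pow, clipLevel_sq hs hN]; field_simp; norm_num
  rw [e5, playProb, weight, mul_pow (1 / √N), div_pow, Real.sq_sqrt hN.le]
  generalize level s (1 / √N) G - G i = w at *
  generalize rate s N = r at *
  have hN' : N = s.card / r ^ 2 := by rw [hr]; field_simp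
  generalize (s.card : ℝ) = K at *
  subst hN'
  have e1 : ((1 - r / 2) * (1 / (1 ^ 2 / (K / r ^ 2) * w ^ 2)) + r / 2 / K) * w =
      (1 - r / 2) * (K / (r ^ 2 * w)) + r / 2 / K * w := by
    field_simp
  rw [e1]
  have e2 : 0 < K / (r ^ 2 * w) := by positivity
  have e3 : K / (r ^ 2 * w) * (r / 2 / K * w) = 1 / (2 * r) := by field_simp
  have e4 : 0 < r / 2 / K * w := by positivity
  rw [← e3]
  generalize K / (r ^ 2 * w) = a at *
  generalize r / 2 / K * w = b at *
  have : a / 2 + b ≤ (1 - r / 2) * a + b := by nlinarith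
  calc a * b ≤ (a / 2 + b) ^ 2 := by nlinarith
    _ ≤ _ := by gcongr

end Sampling

/-! ### One round of the finite-armed algorithm -/

section Round

variable {A : Type*}

open Classical in
/-- The importance-weighted estimate of the gain of `i` from the observed action and reward. -/
def estimate (s : Finset A) (N : ℝ) (G : A → ℝ) (z : A × ℝ) (i : A) : ℝ :=
  if z.1 = i ∧ i ∈ s then min z.2 (clipLevel s N) / playProb s N G i else 0

/-- The bound on the potential increase when `i` is played and `y` is observed. -/
def stepBound (s : Finset A) (N : ℝ) (G : A → ℝ) (i : A) (y : ℝ) : ℝ :=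
  weight s (1 / √N) G i * (min y (clipLevel s N) / playProb s N G i) +
    2 * weight s (1 / √N) G i * (min y (clipLevel s N) / playProb s N G i) ^ 2 /
      (level s (1 / √N) G - G i)

open Classical in
/-- `stepBound` at the observed action and reward, zero outside the action set `s`. -/
def stepCost (s : Finset A) (N : ℝ) (G : A → ℝ) (z : A × ℝ) : ℝ :=
  ∑ i ∈ s, if z.1 = i then stepBound s N G i z.2 else 0

variable {s : Finset A} {N : ℝ}

lemma stepCost_of_mem (G : A → ℝ) {x : A} (hx : x ∈ s) (y : ℝ) :
    stepCost s N G (x, y) = stepBound s N G x y := by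
  classical
  simp [stepCost, hx]

lemma potential_add_estimate_le (hs : s.Nonempty) (hN : 0 < N) (hsN : s.card ≤ N) (G : A → ℝ)
    (z : A × ℝ) :
    potential s (1 / √N) (level s (1 / √N) (G + estimate s N G z)) (G + estimate s N G z) ≤
      potential s (1 / √N) (level s (1 / √N) G) G + stepCost s N G z := by
  obtain ⟨x, y⟩ := z
  have hη : 0 < 1 / √N := by positivity
  by_cases hx : x ∈ s
  · rw [stepCost_of_mem G hx, stepBound, ← add_assoc]
    refine potential_step hs hη hx ?_ ?_ ?_
    · have hq := playProb_pos hs hN hsN G x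
      have h := two_mul_clipLevel_le hs hN hsN G hx
      rw [mul_div_assoc', div_le_iff₀ hq]
      linarith [min_le_right y (clipLevel s N)]
    · simp [estimate, hx]
    · intro i hi
      simp [estimate, hi.symm]
  · have h0 : estimate s N G (x, y) = 0 := by
      funext i
      simp only [estimate, Pi.zero_apply]
      rw [if_neg]
      rintro ⟨rfl, h⟩
      exact hx h
    have h1 : stepCost s N G (x, y) = 0 := by
      refine Finset.sum_eq_zero fun i hi => if_neg ?_
      rintro rfl
      exact hx hi
    rw [h0, h1]; simp

lemma measurable_playProb (hs : s.Nonempty) (hN : 0 < N) (i : A) :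
    Measurable (fun G : A → ℝ => playProb s N G i) := by
  have := measurable_weight (s := s) (η := 1 / √N) hs (by positivity) i
  unfold playProb
  fun_prop

lemma sum_ofReal_playProb (hs : s.Nonempty) (hN : 0 < N) (hsN : s.card ≤ N) (G : A → ℝ) :
    ∑ i ∈ s, ENNReal.ofReal (playProb s N G i) = 1 := by
  rw [← ENNReal.ofReal_sum_of_nonneg fun i _ => (playProb_pos hs hN hsN G i).le,
    sum_playProb hs hN, ENNReal.ofReal_one]

/-- The reward, plus the estimated gain of `i`, minus the potential increase. -/
def roundGain (s : Finset A) (N : ℝ) (i : A) (p : (A → ℝ) × (A × ℝ)) : ℝ :=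
  p.2.2 + estimate s N p.1 p.2 i - stepCost s N p.1 p.2

/-- Supplies integrability only: `D` may depend on `s` and `N`, but not on the unbounded state `G`.
-/
lemma exists_abs_roundGain_le (hs : s.Nonempty) (hN : 0 < N) (hsN : s.card ≤ N) (i : A) :
    ∃ D : ℝ, 0 ≤ D ∧ ∀ G : A → ℝ, ∀ x ∈ s, ∀ y : ℝ,
      |roundGain s N i (G, (x, y))| ≤ D * (1 + y ^ 2) := by
  have hK : (0 : ℝ) < s.card := by exact_mod_cast hs.card_pos
  have hr := rate_pos hs hN
  have hB := clipLevel_pos hs hN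
  set B := clipLevel s N with hBdef
  set q₀ := rate s N / 2 / s.card with hq₀
  have hq₀' : 0 < q₀ := by positivity
  refine ⟨1 + (1 + B) / q₀ + 2 * (1 + B) + 2 / B, by positivity, fun G x hx y => ?_⟩
  have hη : 0 < 1 / √N := by positivity
  have hw : 0 < level s (1 / √N) G - G x := sub_pos.2 (lt_level hs hη G hx)
  have hc : |min y B| ≤ (1 + B) * (1 + y ^ 2) := by
    have h1 : |y| ≤ 1 + y ^ 2 := by nlinarith [sq_abs y, sq_nonneg (|y| - 1)]
    have h2 : |min y B| ≤ |y| + B := by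
      rcases le_total y B with h | h
      · rw [min_eq_left h]; linarith
      · rw [min_eq_right h, abs_of_pos hB]; linarith [abs_nonneg y]
    nlinarith [sq_nonneg y]
  have hy : |y| ≤ 1 * (1 + y ^ 2) := by nlinarith [sq_abs y, sq_nonneg (|y| - 1)]
  have he : |estimate s N G (x, y) i| ≤ (1 + B) / q₀ * (1 + y ^ 2) := by
    unfold estimate
    split_ifs with h
    · rw [abs_div, abs_of_pos (playProb_pos hs hN hsN G i), div_mul_eq_mul_div]
      have := le_playProb hN hsN G i
      gcongr
    · rw [abs_zero]; positivity
  have hqx := playProb_pos hs hN hsN G x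
  have hpq := weight_le_two_mul_playProb hs hN hsN G x
  have hp := weight_nonneg (s := s) (η := 1 / √N) G x
  have hqw := two_mul_clipLevel_le hs hN hsN G hx
  rw [← hBdef] at hqw
  have hc1 : |stepCost s N G (x, y)| ≤ 2 * (1 + B) * (1 + y ^ 2) + 2 / B * (1 + y ^ 2) := by
    rw [stepCost_of_mem G hx, stepBound, ← hBdef]
    generalize weight s (1 / √N) G x = p at *
    generalize playProb s N G x = q at *
    generalize level s (1 / √N) G - G x = w at *
    refine (abs_add_le _ _).trans (add_le_add ?_ ?_)
    · rw [abs_mul, abs_div, abs_of_nonneg hp, abs_of_pos hqx, mul_assoc]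
      calc p * (|min y B| / q) = (p / q) * |min y B| := by ring
        _ ≤ 2 * ((1 + B) * (1 + y ^ 2)) := by
          gcongr
          exact (div_le_iff₀ hqx).2 hpq
    · rw [abs_of_nonneg (by positivity)]
      have h3 : (min y B) ^ 2 ≤ 1 + y ^ 2 := (min_sq_le hB.le).trans (by linarith)
      calc 2 * p * (min y B / q) ^ 2 / w = 2 * (p / q) * (min y B) ^ 2 / (q * w) := by
            field_simp
        _ ≤ 2 * 2 * (1 + y ^ 2) / (2 * B) := by
          gcongr
          exact (div_le_iff₀ hqx).2 hpq
        _ = 2 / B * (1 + y ^ 2) := by field_simp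
  unfold roundGain
  calc _ ≤ |y| + |estimate s N G (x, y) i| + |stepCost s N G (x, y)| :=
        (abs_sub _ _).trans (by gcongr; exact abs_add_le _ _)
    _ ≤ _ := by linarith

lemma measurable_stepBound (hs : s.Nonempty) (hN : 0 < N) (i : A) :
    Measurable (fun p : (A → ℝ) × ℝ => stepBound s N p.1 i p.2) := by
  have hη : 0 < 1 / √N := by positivity
  have h1 : Measurable (fun p : (A → ℝ) × ℝ => weight s (1 / √N) p.1 i) :=
    (measurable_weight hs hη i).comp measurable_fst
  have h2 : Measurable (fun p : (A → ℝ) × ℝ => playProb s N p.1 i) :=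
    (measurable_playProb hs hN i).comp measurable_fst
  have h3 : Measurable (fun p : (A → ℝ) × ℝ => level s (1 / √N) p.1) :=
    (measurable_level hs hη).comp measurable_fst
  unfold stepBound
  fun_prop

variable [MeasurableSpace A]

/-- The kernel that plays `i ∈ s` with probability `playProb s N G i`. -/
def playKernel (s : Finset A) (N : ℝ) (hs : s.Nonempty) (hN : 0 < N) : Kernel (A → ℝ) A where
  toFun G := ∑ i ∈ s, ENNReal.ofReal (playProb s N G i) • Measure.dirac i
  measurable' := by
    refine Measure.measurable_of_measurable_coe _ fun t _ => ?_
    simp only [Measure.coe_finsetSum, Finset.sum_apply, Measure.smul_apply, smul_eq_mul]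
    exact Finset.measurable_fun_sum _ fun i _ =>
      ((measurable_playProb hs hN i).ennreal_ofReal).mul_const _

lemma playKernel_apply (hs : s.Nonempty) (hN : 0 < N) (G : A → ℝ) :
    playKernel s N hs hN G = ∑ i ∈ s, ENNReal.ofReal (playProb s N G i) • Measure.dirac i := rfl

variable {μ : A → ℝ} {ν : Kernel A ℝ} [IsMarkovKernel ν]

lemma lintegral_one_add_sq_le (hν : IsRewardKernel μ ν) (hμ : ∀ x, μ x ∈ Set.Icc (0 : ℝ) 1)
    {D : ℝ} (hD : 0 ≤ D) {f : ℝ → ℝ} (hf : ∀ y, |f y| ≤ D * (1 + y ^ 2)) (x : A) :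
    ∫⁻ y, ‖f y‖ₑ ∂(ν x) ≤ ENNReal.ofReal (D * (1 + 4 * Real.exp (3 / 2))) := by
  have hi : Integrable (fun y => D * (1 + y ^ 2)) (ν x) :=
    ((integrable_const 1).add (integrable_sq_of_subgaussian (hν.subgaussian x))).const_mul D
  calc ∫⁻ y, ‖f y‖ₑ ∂(ν x) ≤ ∫⁻ y, ENNReal.ofReal (D * (1 + y ^ 2)) ∂(ν x) := by
        refine lintegral_mono fun y => ?_
        rw [Real.enorm_eq_ofReal_abs]
        exact ENNReal.ofReal_le_ofReal (hf y)
    _ = ENNReal.ofReal (∫ y, D * (1 + y ^ 2) ∂(ν x)) :=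
        (ofReal_integral_eq_lintegral_ofReal hi (ae_of_all _ fun y => by positivity)).symm
    _ ≤ _ := by
        refine ENNReal.ofReal_le_ofReal ?_
        rw [integral_const_mul, integral_add (integrable_const _)
          (integrable_sq_of_subgaussian (hν.subgaussian x))]
        have := integral_sq_le_of_subgaussian (hν.subgaussian x) (hμ x)
        gcongr
        simp

lemma isMarkovKernel_playKernel (hs : s.Nonempty) (hN : 0 < N) (hsN : s.card ≤ N) :
    IsMarkovKernel (playKernel s N hs hN) := by
  refine ⟨fun G => ⟨?_⟩⟩
  rw [playKernel_apply]
  simp [sum_ofReal_playProb hs hN hsN]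

lemma integral_roundGain (hs : s.Nonempty) (hN : 0 < N) (hν : IsRewardKernel μ ν) (G : A → ℝ)
    (i : A) {x : A} (hx : x ∈ s) :
    ∫ y, roundGain s N i (G, (x, y)) ∂(ν x) = μ x + (∫ y, estimate s N G (x, y) i ∂(ν x)) -
      (weight s (1 / √N) G x / playProb s N G x * (∫ y, min y (clipLevel s N) ∂(ν x)) +
        2 * weight s (1 / √N) G x / playProb s N G x ^ 2 / (level s (1 / √N) G - G x) *
          (∫ y, (min y (clipLevel s N)) ^ 2 ∂(ν x))) := by
  have hS := hν.subgaussian x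
  have i1 := integrable_id_of_subgaussian hS
  have i2 := integrable_min_of_subgaussian hS (clipLevel s N)
  have i3 := integrable_min_sq_of_subgaussian hS (clipLevel_pos hs hN).le
  have i4 : Integrable (fun y => estimate s N G (x, y) i) (ν x) := by
    by_cases h : x = i ∧ i ∈ s
    · simpa only [estimate, h, and_self, if_true] using i2.div_const _
    · simp only [estimate, h, if_false, integrable_const]
  have e : ∀ y, roundGain s N i (G, (x, y)) = y + estimate s N G (x, y) i -
      (weight s (1 / √N) G x / playProb s N G x * min y (clipLevel s N) +
        2 * weight s (1 / √N) G x / playProb s N G x ^ 2 / (level s (1 / √N) G - G x) *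
          (min y (clipLevel s N)) ^ 2) := fun y => by
    rw [roundGain, stepCost_of_mem G hx, stepBound]; ring
  simp_rw [e]
  rw [integral_sub (by exact i1.add i4) (by exact (i2.const_mul _).add (i3.const_mul _)),
    integral_add i1 i4, integral_add (i2.const_mul _) (i3.const_mul _), integral_const_mul,
    integral_const_mul, hν.mean]

variable [MeasurableSingletonClass A]

lemma measurable_estimate (hs : s.Nonempty) (hN : 0 < N) (i : A) :
    Measurable (fun p : (A → ℝ) × (A × ℝ) => estimate s N p.1 p.2 i) := by
  have h2 : Measurable (fun p : (A → ℝ) × (A × ℝ) => playProb s N p.1 i) :=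
    (measurable_playProb hs hN i).comp measurable_fst
  unfold estimate
  refine Measurable.ite ?_ (by fun_prop) measurable_const
  have h3 : Measurable (fun p : (A → ℝ) × (A × ℝ) => p.2.1) := by fun_prop
  exact (h3 (measurableSet_singleton i)).inter (MeasurableSet.const _)

lemma measurable_stepCost (hs : s.Nonempty) (hN : 0 < N) :
    Measurable (fun p : (A → ℝ) × (A × ℝ) => stepCost s N p.1 p.2) := by
  unfold stepCost
  refine Finset.measurable_fun_sum _ fun i _ => Measurable.ite ?_ ?_ measurable_const
  · have h : Measurable (fun p : (A → ℝ) × (A × ℝ) => p.2.1) := by fun_prop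
    exact h (measurableSet_singleton i)
  · have h : Measurable (fun p : (A → ℝ) × (A × ℝ) => (p.1, p.2.2)) := by fun_prop
    have hc := (measurable_stepBound hs hN i).comp h
    simp only [Function.comp_def] at hc
    exact hc

lemma lintegral_playKernel_le (hs : s.Nonempty) (hN : 0 < N) (hsN : s.card ≤ N) (G : A → ℝ)
    {f : A → ENNReal} {b : ENNReal} (hf : ∀ i ∈ s, f i ≤ b) :
    ∫⁻ x, f x ∂(playKernel s N hs hN G) ≤ b := by
  rw [playKernel_apply, lintegral_finsetSum_measure]
  simp only [lintegral_smul_measure, lintegral_dirac, smul_eq_mul]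
  calc _ ≤ ∑ i ∈ s, ENNReal.ofReal (playProb s N G i) * b :=
        Finset.sum_le_sum fun i hi => by gcongr; exact hf i hi
    _ = b := by rw [← Finset.sum_mul, sum_ofReal_playProb hs hN hsN, one_mul]

lemma integral_playKernel (hs : s.Nonempty) (hN : 0 < N) (hsN : s.card ≤ N) (G : A → ℝ)
    (f : A → ℝ) :
    ∫ x, f x ∂(playKernel s N hs hN G) = ∑ i ∈ s, playProb s N G i * f i := by
  rw [playKernel_apply, integral_finsetSum_measure fun i _ =>
    (integrable_dirac (by finiteness)).smul_measure (by simp)]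
  refine Finset.sum_congr rfl fun i _ => ?_
  rw [integral_smul_measure, integral_dirac, ENNReal.toReal_ofReal
    (playProb_pos hs hN hsN G i).le, smul_eq_mul]

lemma measurable_roundGain (hs : s.Nonempty) (hN : 0 < N) (i : A) :
    Measurable (roundGain s N i) :=
  ((measurable_snd.comp measurable_snd).add (measurable_estimate hs hN i)).sub
    (measurable_stepCost hs hN)

/-- In every state, the conditional mean of `roundGain` is at least `μ i - O(√(K / N))`. -/
lemma le_integral_roundGain (hs : s.Nonempty) (hN : 0 < N) (hsN : s.card ≤ N)
    (hν : IsRewardKernel μ ν) (hμ : ∀ x, μ x ∈ Set.Icc (0 : ℝ) 1) (G : A → ℝ) {i : A}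
    (hi : i ∈ s) :
    μ i - 33 * Real.exp (3 / 2) * rate s N ≤
      ∫ x, ∫ y, roundGain s N i (G, (x, y)) ∂(ν x) ∂(playKernel s N hs hN G) := by
  have hη : 0 < 1 / √N := by positivity
  have hr := rate_pos hs hN
  have hr1 := rate_le_one hN hsN
  rw [integral_playKernel hs hN hsN]
  set E := Real.exp (3 / 2) with hE
  have hE1 : 1 ≤ E := Real.one_le_exp (by norm_num)
  -- Importance weighting is unbiased for the clipped reward: the playing probability cancels.
  have hest : ∑ x ∈ s, playProb s N G x * (∫ y, estimate s N G (x, y) i ∂(ν x)) =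
      ∫ y, min y (clipLevel s N) ∂(ν i) := by
    rw [Finset.sum_eq_single_of_mem i hi]
    · simp only [estimate, hi, and_self, if_true]
      rw [integral_div]
      have := (playProb_pos hs hN hsN G i).ne'
      field_simp
    · intro x _ hx
      simp [estimate, hx]
  -- Only the comparator pays for clipping. For the played arms, a clipped mean below `μ x` has the
  -- favourable sign (`hm`).
  have hbias : μ i - 16 * E * rate s N ≤ ∫ y, min y (clipLevel s N) ∂(ν i) := by
    have h := sub_le_integral_min_of_subgaussian (hν.subgaussian i) (hμ i) (hν.mean i)
      (clipLevel_pos hs hN)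
    rw [clipLevel_sq hs hN] at h
    convert h using 2
    rw [hE]; field_simp; norm_num
  have hterm : ∀ x ∈ s, playProb s N G x * (μ x -
      (weight s (1 / √N) G x / playProb s N G x * (∫ y, min y (clipLevel s N) ∂(ν x)) +
        2 * weight s (1 / √N) G x / playProb s N G x ^ 2 / (level s (1 / √N) G - G x) *
          (∫ y, (min y (clipLevel s N)) ^ 2 ∂(ν x)))) ≥
      -(rate s N / 2) * weight s (1 / √N) G x -
        16 * E * (1 / (level s (1 / √N) G - G x)) := by
    intro x hx
    have hS := hν.subgaussian x
    have hq := playProb_pos hs hN hsN G x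
    have hp := weight_nonneg (s := s) (η := 1 / √N) G x
    have hpq := weight_le_two_mul_playProb hs hN hsN G x
    have hw : 0 < level s (1 / √N) G - G x := sub_pos.2 (lt_level hs hη G hx)
    have hm : ∫ y, min y (clipLevel s N) ∂(ν x) ≤ μ x := by
      rw [← hν.mean x]
      exact integral_mono (integrable_min_of_subgaussian hS _) (integrable_id_of_subgaussian hS)
        fun y => min_le_left _ _
    have hv : ∫ y, (min y (clipLevel s N)) ^ 2 ∂(ν x) ≤ 4 * E :=
      (integral_mono (integrable_min_sq_of_subgaussian hS (clipLevel_pos hs hN).le)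
        (integrable_sq_of_subgaussian hS) fun y => min_sq_le (clipLevel_pos hs hN).le).trans
        (integral_sq_le_of_subgaussian hS (hμ x))
    have hv0 : 0 ≤ ∫ y, (min y (clipLevel s N)) ^ 2 ∂(ν x) :=
      integral_nonneg fun y => sq_nonneg _
    have hdiff : -(rate s N / 2) * weight s (1 / √N) G x ≤
        (playProb s N G x - weight s (1 / √N) G x) * μ x := by
      have h0 := (hμ x).1
      have h1 := (hμ x).2
      have hk : 0 ≤ rate s N / 2 / s.card := by positivity
      have : playProb s N G x - weight s (1 / √N) G x =
        rate s N / 2 / s.card - rate s N / 2 * weight s (1 / √N) G x := by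
        unfold playProb; ring
      rw [this, sub_mul]
      have h2 : rate s N / 2 * weight s (1 / √N) G x * μ x ≤
        rate s N / 2 * weight s (1 / √N) G x := mul_le_of_le_one_right (by positivity) h1
      have h3 := mul_nonneg hk h0
      linarith
    generalize weight s (1 / √N) G x = p at *
    generalize playProb s N G x = q at *
    generalize level s (1 / √N) G - G x = w at *
    generalize ∫ y, (min y (clipLevel s N)) ^ 2 ∂(ν x) = v at *
    generalize ∫ y, min y (clipLevel s N) ∂(ν x) = m at *
    have e1 : q * (μ x - (p / q * m + 2 * p / q ^ 2 / w * v)) =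
        q * μ x - p * m - 2 * (p / q) * v / w := by
      field_simp; ring
    rw [e1]
    have e2 : 2 * (p / q) * v / w ≤ 2 * 2 * (4 * E) / w := by
      gcongr
      exact (div_le_iff₀ hq).2 hpq
    have e3 : p * m ≤ p * μ x := by gcongr
    have e4 : 2 * 2 * (4 * E) / w = 16 * E * (1 / w) := by ring
    linarith
  have hsum := Finset.sum_le_sum hterm
  rw [Finset.sum_sub_distrib, ← Finset.mul_sum, ← Finset.mul_sum, sum_weight hs hη] at hsum
  have hinv := sum_inv_level_sub_le hs hη G
  have hrate : √s.card * (1 / √N) = rate s N := by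
    rw [rate, Real.sqrt_div (by positivity)]; ring
  rw [hrate] at hinv
  have hinv2 := mul_le_mul_of_nonneg_left hinv (show 0 ≤ 16 * E by positivity)
  have htot : ∑ x ∈ s, playProb s N G x * ∫ y, roundGain s N i (G, (x, y)) ∂(ν x) =
      (∑ x ∈ s, playProb s N G x * (∫ y, estimate s N G (x, y) i ∂(ν x))) +
      ∑ x ∈ s, playProb s N G x * (μ x -
      (weight s (1 / √N) G x / playProb s N G x * (∫ y, min y (clipLevel s N) ∂(ν x)) +
        2 * weight s (1 / √N) G x / playProb s N G x ^ 2 / (level s (1 / √N) G - G x) *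
          (∫ y, (min y (clipLevel s N)) ^ 2 ∂(ν x)))) := by
    rw [← Finset.sum_add_distrib]
    refine Finset.sum_congr rfl fun x hx => ?_
    rw [integral_roundGain hs hN hν G i hx]
    ring
  rw [htot, hest]
  -- The constant `33` covers `16` from clipping bias, `16` from the second-order term and `1 / 2`
  -- from exploration, using `1 ≤ E`.
  nlinarith

end Round

/-! ### Restarting in epochs of doubling length -/

section Epochs

variable {A : Type*}

/-- Round `t` lies in the epoch `e` with `2 ^ e ≤ t + 1 < 2 ^ (e + 1)`. -/
def epoch (t : ℕ) : ℕ := Nat.log 2 (t + 1)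

lemma epoch_eq {e j : ℕ} (hj : j < 2 ^ e) : epoch (2 ^ e - 1 + j) = e := by
  have h := Nat.one_le_two_pow (n := e)
  refine Nat.log_eq_of_pow_le_of_lt_pow (by omega) ?_
  rw [pow_succ]; omega

open Classical in
/-- Within an epoch the gain estimates are accumulated; at the end of an epoch they are reset. -/
def epochUpdate (arms : ℕ → Finset A) (t : ℕ) (p : (A → ℝ) × (A × ℝ)) : A → ℝ :=
  if epoch (t + 1) = epoch t then p.1 + estimate (arms (epoch t)) (2 ^ epoch t) p.1 p.2 else 0

variable {arms : ℕ → Finset A}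

lemma stateAt_epoch_start (e : ℕ) (ω : ℕ → A × ℝ) :
    stateAt 0 (epochUpdate arms) (2 ^ e - 1) ω = 0 := by
  cases e with
  | zero => rfl
  | succ e =>
    have h := Nat.one_le_two_pow (n := e)
    have h1 : 2 ^ (e + 1) - 1 = (2 ^ e - 1 + (2 ^ e - 1)) + 1 := by rw [pow_succ]; omega
    have h2 := epoch_eq (e := e + 1) (j := 0) (by positivity)
    rw [add_zero, h1] at h2
    rw [h1, stateAt, epochUpdate, if_neg]
    rw [h2, epoch_eq (by omega)]
    omega

lemma stateAt_epoch_succ {e j : ℕ} (hj : j + 1 < 2 ^ e) (ω : ℕ → A × ℝ) :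
    stateAt 0 (epochUpdate arms) (2 ^ e - 1 + (j + 1)) ω =
      stateAt 0 (epochUpdate arms) (2 ^ e - 1 + j) ω +
        estimate (arms e) (2 ^ e) (stateAt 0 (epochUpdate arms) (2 ^ e - 1 + j) ω)
          (ω (2 ^ e - 1 + j)) := by
  rw [← add_assoc, stateAt, epochUpdate, add_assoc, epoch_eq hj, epoch_eq (by omega), if_pos rfl]

lemma sum_roundGain_le (hne : ∀ e, (arms e).Nonempty)
    (hcard : ∀ e, ((arms e).card : ℝ) ≤ 2 ^ e) {e n : ℕ} (hn : n ≤ 2 ^ e) {i : A}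
    (hi : i ∈ arms e) (ω : ℕ → A × ℝ) :
    ∑ j ∈ Finset.range n, roundGain (arms e) (2 ^ e) i
      (stateAt 0 (epochUpdate arms) (2 ^ e - 1 + j) ω, ω (2 ^ e - 1 + j)) ≤
    ∑ j ∈ Finset.range n, (ω (2 ^ e - 1 + j)).2 + 2 * √((arms e).card * 2 ^ e) := by
  set st := fun j => stateAt 0 (epochUpdate arms) (2 ^ e - 1 + j) ω with hst
  set s := arms e
  set N : ℝ := 2 ^ e with hN
  have hN0 : 0 < N := by positivity
  have hη : 0 < 1 / √N := by positivity
  -- The actual state is reset after the last round of the epoch, so it agrees with `G j` only for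
  -- `j < 2 ^ e`. The unreset sum also makes sense at `j = 2 ^ e`, where the potential bound is
  -- still needed.
  set G : ℕ → A → ℝ := fun j => ∑ k ∈ Finset.range j, estimate s N (st k) (ω (2 ^ e - 1 + k))
    with hG
  have hGs : ∀ j, G (j + 1) = G j + estimate s N (st j) (ω (2 ^ e - 1 + j)) := fun j => by
    simp only [hG, Finset.sum_range_succ]
  have hstG : ∀ j < 2 ^ e, st j = G j := by
    intro j
    induction j with
    | zero => intro _; simpa [hst, hG] using stateAt_epoch_start e ω
    | succ j ih =>
      intro hj
      rw [hGs, ← ih (by omega)]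
      exact stateAt_epoch_succ hj ω
  have hpot : ∀ j ≤ 2 ^ e, potential s (1 / √N) (level s (1 / √N) (G j)) (G j) ≤
      2 * √s.card / (1 / √N) +
        ∑ k ∈ Finset.range j, stepCost s N (st k) (ω (2 ^ e - 1 + k)) := by
    intro j
    induction j with
    | zero =>
      intro _
      simpa [hG] using potential_level_zero_le (hne e) hη
    | succ j ih =>
      intro hj
      rw [Finset.sum_range_succ, hGs, hstG j (by omega)]
      have h1 := potential_add_estimate_le (hne e) hN0 (hcard e) (G j) (ω (2 ^ e - 1 + j))
      have h2 := ih (by omega)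
      linarith
  have h1 := (le_potential_level (hne e) hη (G n) hi).trans (hpot n hn)
  have h2 : 2 * √s.card / (1 / √N) = 2 * √(s.card * N) := by
    rw [Real.sqrt_mul (by positivity)]; field_simp
  rw [h2] at h1
  simp only [hG, Finset.sum_apply] at h1
  simp only [roundGain, Finset.sum_sub_distrib, Finset.sum_add_distrib]
  linarith

variable [MeasurableSpace A] [MeasurableSingletonClass A]

lemma measurable_epochUpdate (hne : ∀ e, (arms e).Nonempty) (t : ℕ) :
    Measurable (epochUpdate arms t) := by
  unfold epochUpdate
  split_ifs
  · refine measurable_fst.add (measurable_pi_lambda _ fun i => ?_)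
    exact measurable_estimate (hne _) (by positivity) i
  · exact measurable_const

/-- The kernel from which the algorithm plays in round `t`. -/
def epochKernel (hne : ∀ e, (arms e).Nonempty) (t : ℕ) : Kernel (A → ℝ) A :=
  playKernel (arms (epoch t)) (2 ^ epoch t) (hne _) (by positivity)

variable (hne : ∀ e, (arms e).Nonempty) (hcard : ∀ e, ((arms e).card : ℝ) ≤ 2 ^ e)

/-- The algorithm that runs Tsallis-regularized sampling on `arms e` during epoch `e`. -/
def epochPolicy : Policy A :=
  have : ∀ t, IsMarkovKernel (epochKernel hne t) := fun _ =>
    isMarkovKernel_playKernel _ _ (hcard _)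
  statePolicy 0 (epochKernel hne) (epochUpdate arms) (measurable_epochUpdate hne)

variable {μ : A → ℝ} {ν : Kernel A ℝ} [IsMarkovKernel ν]

lemma integrable_and_le_integral_epochPolicy (hν : IsRewardKernel μ ν)
    (hμ : ∀ x, μ x ∈ Set.Icc (0 : ℝ) 1) (t : ℕ) {f : (A → ℝ) × (A × ℝ) → ℝ} (hf : Measurable f)
    {D : ℝ} (hD : 0 ≤ D)
    (hfD : ∀ G, ∀ x ∈ arms (epoch t), ∀ y, |f (G, (x, y))| ≤ D * (1 + y ^ 2)) {c : ℝ}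
    (hc : ∀ G, c ≤ ∫ x, ∫ y, f (G, (x, y)) ∂(ν x) ∂(epochKernel hne t G)) :
    Integrable (fun ω => f (stateAt 0 (epochUpdate arms) t ω, ω t))
      (runLaw (epochPolicy hne hcard) ν) ∧
    c ≤ ∫ ω, f (stateAt 0 (epochUpdate arms) t ω, ω t) ∂(runLaw (epochPolicy hne hcard) ν) := by
  have : ∀ t, IsMarkovKernel (epochKernel hne t) := fun _ =>
    isMarkovKernel_playKernel _ _ (hcard _)
  refine integrable_and_le_integral_round 0 (epochKernel hne) (epochUpdate arms)
    (measurable_epochUpdate hne) ν t hf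
    (b := ENNReal.ofReal (D * (1 + 4 * Real.exp (3 / 2)))) ENNReal.ofReal_ne_top (fun G => ?_) hc
  exact lintegral_playKernel_le _ _ (hcard _) G fun x hx =>
    lintegral_one_add_sq_le hν hμ hD (hfD G x hx) x

/-- Rewards are integrable, with mean at least any lower bound of the mean rewards. -/
lemma integrable_reward_and_le (hν : IsRewardKernel μ ν) (hμ : ∀ x, μ x ∈ Set.Icc (0 : ℝ) 1)
    {c : ℝ} (hc : ∀ x, c ≤ μ x) (t : ℕ) :
    Integrable (fun ω => (ω t).2) (runLaw (epochPolicy hne hcard) ν) ∧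
      c ≤ ∫ ω, (ω t).2 ∂(runLaw (epochPolicy hne hcard) ν) := by
  refine integrable_and_le_integral_epochPolicy hne hcard hν hμ t (f := fun p => p.2.2)
    (by fun_prop) zero_le_one (fun G x _ y => ?_) fun G => ?_
  · simp only
    nlinarith [sq_abs y, sq_nonneg (|y| - 1)]
  · have hs := hne (epoch t)
    have hN : (0 : ℝ) < 2 ^ epoch t := by positivity
    rw [epochKernel, integral_playKernel hs hN (hcard _)]
    simp only [hν.mean]
    calc c = ∑ i ∈ arms (epoch t), playProb (arms (epoch t)) (2 ^ epoch t) G i * c := by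
          rw [← Finset.sum_mul, sum_playProb hs hN, one_mul]
      _ ≤ _ := Finset.sum_le_sum fun i _ =>
          mul_le_mul_of_nonneg_left (hc i) (playProb_pos hs hN (hcard _) G i).le

/-- The regret against a fixed action of `arms e` in the first `n` rounds of epoch `e`. -/
lemma sum_epoch_regret_le (hν : IsRewardKernel μ ν) (hμ : ∀ x, μ x ∈ Set.Icc (0 : ℝ) 1)
    {e n : ℕ} (hn : n ≤ 2 ^ e) {i : A} (hi : i ∈ arms e) :
    n * μ i - ∑ j ∈ Finset.range n, ∫ ω, (ω (2 ^ e - 1 + j)).2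
      ∂(runLaw (epochPolicy hne hcard) ν) ≤
      (33 * Real.exp (3 / 2) + 2) * √((arms e).card * 2 ^ e) := by
  set P := runLaw (epochPolicy hne hcard) ν with hP
  have hN : (0 : ℝ) < 2 ^ e := by positivity
  set c := μ i - 33 * Real.exp (3 / 2) * rate (arms e) (2 ^ e) with hc
  obtain ⟨D, hD, hDb⟩ := exists_abs_roundGain_le (hne e) hN (hcard e) i
  have hround : ∀ j < n, Integrable (fun ω => roundGain (arms e) (2 ^ e) i
        (stateAt 0 (epochUpdate arms) (2 ^ e - 1 + j) ω, ω (2 ^ e - 1 + j))) P ∧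
      c ≤ ∫ ω, roundGain (arms e) (2 ^ e) i
        (stateAt 0 (epochUpdate arms) (2 ^ e - 1 + j) ω, ω (2 ^ e - 1 + j)) ∂P := by
    intro j hj
    have he := epoch_eq (e := e) (j := j) (by omega)
    refine integrable_and_le_integral_epochPolicy hne hcard hν hμ _
      (measurable_roundGain (hne e) hN i) hD (by rwa [he]) fun G => ?_
    have h := le_integral_roundGain (hne e) hN (hcard e) hν hμ G hi
    unfold epochKernel
    simp only [he]
    exact h
  have hrew : ∀ j, Integrable (fun ω => (ω (2 ^ e - 1 + j)).2) P := fun j =>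
    (integrable_reward_and_le hne hcard hν hμ (fun x => (hμ x).1) _).1
  have h1 := integral_mono (μ := P)
    (integrable_finsetSum _ fun j hj => (hround j (Finset.mem_range.1 hj)).1)
    ((integrable_finsetSum _ fun j _ => hrew j).add (integrable_const _))
    (sum_roundGain_le hne hcard hn hi)
  rw [integral_finsetSum _ fun j hj => (hround j (Finset.mem_range.1 hj)).1] at h1
  simp only [Pi.add_apply] at h1
  rw [integral_add (integrable_finsetSum _ fun j _ => hrew j) (integrable_const _),
    integral_finsetSum _ fun j _ => hrew j] at h1
  have h2 : n * c ≤ ∑ j ∈ Finset.range n, ∫ ω, roundGain (arms e) (2 ^ e) i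
        (stateAt 0 (epochUpdate arms) (2 ^ e - 1 + j) ω, ω (2 ^ e - 1 + j)) ∂P := by
    have := Finset.sum_le_sum fun j hj => (hround j (Finset.mem_range.1 hj)).2
    simpa using this
  have h3 : (n : ℝ) * rate (arms e) (2 ^ e) ≤ √((arms e).card * 2 ^ e) := by
    have h4 : (2 : ℝ) ^ e * rate (arms e) (2 ^ e) = √((arms e).card * 2 ^ e) := by
      rw [rate, Real.sqrt_div (by positivity), Real.sqrt_mul (by positivity)]
      have := Real.mul_self_sqrt hN.le
      have h0 : 0 < √((2 : ℝ) ^ e) := Real.sqrt_pos.2 hN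
      generalize √((2 : ℝ) ^ e) = q at *
      rw [← this]; field_simp
    rw [← h4]
    have : (n : ℝ) ≤ 2 ^ e := by exact_mod_cast hn
    have := rate_pos (hne e) hN
    gcongr
  have h5 := mul_le_mul_of_nonneg_left h3 (show 0 ≤ 33 * Real.exp (3 / 2) by positivity)
  simp only [integral_const, probReal_univ, one_smul] at h1
  rw [hc] at h2
  nlinarith

end Epochs

/-! ### Discretization of the cell and choice of scale -/

section Grid

variable {d : ℕ} {h : ℝ} {C : Set (EuclideanSpace ℝ (Fin d))}

lemma norm_le_sqrt_mul_of_abs_le {x : EuclideanSpace ℝ (Fin d)} {r : ℝ} (hr : 0 ≤ r)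
    (hx : ∀ i, |x i| ≤ r) : ‖x‖ ≤ √d * r := by
  rw [EuclideanSpace.norm_eq]
  refine Real.sqrt_le_iff.2 ⟨by positivity, ?_⟩
  rw [mul_pow, Real.sq_sqrt (by positivity)]
  calc ∑ i, ‖x i‖ ^ 2 ≤ ∑ _i : Fin d, r ^ 2 := by
        refine Finset.sum_le_sum fun i _ => ?_
        rw [Real.norm_eq_abs]
        exact pow_le_pow_left₀ (abs_nonneg _) (hx i) 2
    _ = d * r ^ 2 := by simp

lemma IsCell.pos (hd : 1 ≤ d) (hC : IsCell d h C) : 0 < h := by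
  obtain ⟨a, b, hab, -⟩ := hC
  have := hab ⟨0, hd⟩
  linarith

lemma IsCell.norm_sub_le (hd : 1 ≤ d) (hC : IsCell d h C) (x y : C) :
    ‖(x : EuclideanSpace ℝ (Fin d)) - y‖ ≤ √d * h := by
  have hh := hC.pos hd
  obtain ⟨a, b, hab, -, hsub⟩ := hC
  refine norm_le_sqrt_mul_of_abs_le hh.le fun i => ?_
  have h1 := hsub x.2 i
  have h2 := hsub y.2 i
  have h3 := hab i
  rw [PiLp.sub_apply, abs_le]
  constructor <;> linarith

/-- A cell of side `h` has a `√d * h / m`-net of at most `m ^ d` points. -/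
lemma IsCell.exists_net (hd : 1 ≤ d) (hC : IsCell d h C) {m : ℕ} (hm : 0 < m) :
    ∃ s : Finset C, s.Nonempty ∧ s.card ≤ m ^ d ∧
      ∀ x : C, ∃ y ∈ s, ‖(x : EuclideanSpace ℝ (Fin d)) - y‖ ≤ √d * (h / m) := by
  classical
  have hh := hC.pos hd
  obtain ⟨a, b, hab, hsup, hsub⟩ := hC
  have hm' : (0 : ℝ) < m := by exact_mod_cast hm
  -- Centres of the subboxes lie in the open box, hence in `C` whichever boundary points it
  -- contains.
  have hmem : ∀ k : Fin d → Fin m,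
      WithLp.toLp 2 (fun i => a i + (b i - a i) * (((k i : ℕ) + 1 / 2) / m)) ∈ C := by
    intro k
    refine hsup fun i => ?_
    have h1 := (hab i).1
    have h2 : ((k i : ℕ) : ℝ) + 1 ≤ m := by exact_mod_cast (k i).2
    have h3 : (((k i : ℕ) : ℝ) + 1 / 2) / m < 1 := by
      rw [div_lt_one hm']; linarith
    have h4 : 0 < (((k i : ℕ) : ℝ) + 1 / 2) / m := by positivity
    simp only
    constructor <;> nlinarith
  let f : (Fin d → Fin m) → C := fun k => ⟨_, hmem k⟩
  have : Nonempty (Fin m) := ⟨⟨0, hm⟩⟩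
  refine ⟨Finset.univ.image f, Finset.univ_nonempty.image f,
    Finset.card_image_le.trans (by simp), fun x => ?_⟩
  have hk : ∀ i, ∃ k : Fin m, |x.1 i - (a i + (b i - a i) * (((k : ℕ) + 1 / 2) / m))| ≤ h / m := by
    intro i
    have hx := hsub x.2 i
    have hi := hab i
    have hba : 0 < b i - a i := by linarith
    set v := (x.1 i - a i) / (b i - a i) with hv
    have hxv : x.1 i = a i + (b i - a i) * v := by rw [hv]; field_simp; ring
    have hv0 : 0 ≤ v := div_nonneg (by linarith) hba.le
    have hv1 : v ≤ 1 := (div_le_one hba).2 (by linarith)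
    have key : ∃ k : Fin m, |v * m - ((k : ℕ) + 1 / 2)| ≤ 1 := by
      by_cases hc : v * m < m
      · have hvm : 0 ≤ v * m := by positivity
        refine ⟨⟨⌊v * m⌋₊, (Nat.floor_lt hvm).2 hc⟩, ?_⟩
        have h1 := Nat.floor_le hvm
        have h2 := Nat.lt_floor_add_one (v * m)
        rw [abs_le]; constructor <;> linarith
      -- On the upper face the floor would be `m`, outside `Fin m`.
      · refine ⟨⟨m - 1, by omega⟩, ?_⟩
        have h1 : v * m = m := le_antisymm (by nlinarith) (not_lt.1 hc)
        rw [h1]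
        push_cast [Nat.cast_sub (show 1 ≤ m from hm)]
        rw [abs_le]; constructor <;> linarith
    obtain ⟨k, hk⟩ := key
    refine ⟨k, ?_⟩
    have e : x.1 i - (a i + (b i - a i) * (((k : ℕ) + 1 / 2) / m)) =
        (b i - a i) / m * (v * m - ((k : ℕ) + 1 / 2)) := by
      rw [hxv]; field_simp; ring
    rw [e, abs_mul, abs_of_pos (by positivity)]
    calc (b i - a i) / m * |v * m - ((k : ℕ) + 1 / 2)| ≤ h / m * 1 := by
          gcongr
          exact hi.2
      _ = h / m := mul_one _
  choose k hk using hk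
  exact ⟨f k, Finset.mem_image_of_mem f (Finset.mem_univ k),
    norm_le_sqrt_mul_of_abs_le (by positivity) hk⟩

variable {L : ℝ} {μ : C → ℝ}

lemma IsMeanReward.exists_iSup_sub_le [Nonempty C] (hL : 0 ≤ L) (hμ : IsMeanReward L C μ)
    {s : Finset C} (hs : s.Nonempty) {r : ℝ}
    (hnet : ∀ x : C, ∃ y ∈ s, ‖(x : EuclideanSpace ℝ (Fin d)) - y‖ ≤ r) :
    ∃ i ∈ s, (⨆ x, μ x) - μ i ≤ L * r := by
  obtain ⟨i, hi, hmax⟩ := s.exists_max_image μ hs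
  refine ⟨i, hi, ?_⟩
  rw [sub_le_iff_le_add']
  refine ciSup_le fun x => ?_
  obtain ⟨y, hy, hxy⟩ := hnet x
  have h1 := (le_abs_self _).trans (hμ.lipschitz x y)
  have h2 := hmax y hy
  have h3 := mul_le_mul_of_nonneg_left hxy hL
  linarith

/-- The regret bound of an epoch of `N = 2 ^ e` rounds, with `M = L * h`. -/
def epochBound (d : ℕ) (M : ℝ) (e : ℕ) : ℝ :=
  M ^ ((d : ℝ) / (d + 2)) * ((2 : ℝ) ^ e) ^ (((d : ℝ) + 1) / (d + 2))

/-- The balance between discretization error and the cost of exploring `u ^ d` actions. -/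
lemma exists_balanced_scale (d : ℕ) {M : ℝ} (hM : 0 ≤ M) (e : ℕ) :
    ∃ u : ℝ, 0 ≤ u ∧ 2 ^ e * M = u * epochBound d M e ∧
      √(u ^ d * 2 ^ e) = epochBound d M e := by
  set N : ℝ := 2 ^ e with hN
  have hN0 : 0 < N := by positivity
  have hd : (0 : ℝ) < d + 2 := by positivity
  have hNp : ∀ x y : ℝ, N ^ x * N ^ y = N ^ (x + y) := fun x y => (Real.rpow_add hN0 x y).symm
  -- The solution of `N * M / u = √(u ^ d * N)`; the product form of the claim includes `M = 0`.
  refine ⟨M ^ (2 / ((d : ℝ) + 2)) * N ^ (1 / ((d : ℝ) + 2)), by positivity, ?_, ?_⟩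
  · have h1 : M ^ (2 / ((d : ℝ) + 2)) * M ^ ((d : ℝ) / (d + 2)) = M := by
      rw [← Real.rpow_add_of_nonneg hM (by positivity) (by positivity), ← add_div, add_comm,
        div_self hd.ne', Real.rpow_one]
    have h2 : N ^ (1 / ((d : ℝ) + 2)) * N ^ (((d : ℝ) + 1) / (d + 2)) = N := by
      rw [hNp, ← add_div, show (1 : ℝ) + (d + 1) = d + 2 by ring, div_self hd.ne', Real.rpow_one]
    calc N * M = (N ^ (1 / ((d : ℝ) + 2)) * N ^ (((d : ℝ) + 1) / (d + 2))) *
          (M ^ (2 / ((d : ℝ) + 2)) * M ^ ((d : ℝ) / (d + 2))) := by rw [h1, h2]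
      _ = _ := by unfold epochBound; ring
  · rw [Real.sqrt_eq_iff_mul_self_eq (by positivity) (by unfold epochBound; positivity)]
    have h1 : M ^ ((d : ℝ) / (d + 2)) * M ^ ((d : ℝ) / (d + 2)) =
        (M ^ (2 / ((d : ℝ) + 2))) ^ d := by
      rw [← Real.rpow_add_of_nonneg hM (by positivity) (by positivity), ← Real.rpow_natCast,
        ← Real.rpow_mul hM]
      congr 1; ring
    have h2 : N ^ (((d : ℝ) + 1) / (d + 2)) * N ^ (((d : ℝ) + 1) / (d + 2)) =
        (N ^ (1 / ((d : ℝ) + 2))) ^ d * N := by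
      rw [hNp, ← Real.rpow_natCast, ← Real.rpow_mul hN0.le]
      nth_rewrite 3 [← Real.rpow_one N]
      rw [hNp]
      congr 1; field_simp; ring
    rw [mul_pow, mul_assoc, ← h2, ← h1]
    unfold epochBound; ring

/-- Actions for epoch `e` such that regret `O(√(K N))` against them, together with the trivial
bounds, gives the optimal rate. -/
lemma IsCell.exists_arms (hd : 1 ≤ d) (hC : IsCell d h C) (hL : 0 ≤ L) (e : ℕ) :
    ∃ s : Finset C, s.Nonempty ∧ (s.card : ℝ) ≤ 2 ^ e ∧
      ∀ μ : C → ℝ, IsMeanReward L C μ → ∀ n R c₀ : ℝ, 0 ≤ n → n ≤ 2 ^ e → 1 ≤ c₀ → R ≤ n →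
        R ≤ n * (L * (√d * h)) →
        (∀ i ∈ s, R ≤ n * ((⨆ x, μ x) - μ i) + c₀ * √(s.card * 2 ^ e)) →
        R ≤ (√d + c₀ * 3 ^ d) * epochBound d (L * h) e := by
  have hh := hC.pos hd
  obtain ⟨u, hu, huM, huN⟩ := exists_balanced_scale d (M := L * h) (by positivity) e
  set τ := epochBound d (L * h) e with hτ
  have hτ0 : 0 ≤ τ := by rw [hτ]; unfold epochBound; positivity
  -- The `+ 1` keeps the grid nonempty even for `u = 0`; for `u > 1` the mesh number lies between
  -- `u` and `3 * u`.
  obtain ⟨s, hs, hcard, hnet⟩ := hC.exists_net hd (m := ⌈u⌉₊ + 1) (Nat.succ_pos _)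
  have hne : Nonempty C := ⟨hs.choose⟩
  have hsmall : ∀ n R c₀ : ℝ, n ≤ 2 ^ e → 1 ≤ c₀ → u ≤ 1 → R ≤ n * (L * (√d * h)) →
      R ≤ (√d + c₀ * 3 ^ d) * τ := by
    intro n R c₀ hn hc₀ hu1 hR
    calc R ≤ n * (L * (√d * h)) := hR
      _ ≤ 2 ^ e * (L * (√d * h)) := by gcongr
      _ = √d * (u * τ) := by rw [← huM]; ring
      _ ≤ √d * (1 * τ) := by gcongr
      _ ≤ (√d + c₀ * 3 ^ d) * τ := by
        rw [one_mul]; gcongr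
        have : 0 ≤ c₀ * 3 ^ d := by positivity
        linarith
  have hx₀ : ((({hne.some} : Finset C).card : ℕ) : ℝ) ≤ 2 ^ e := by
    simpa using one_le_pow₀ (M₀ := ℝ) (n := e) one_le_two
  -- For `u ≤ 1` the diameter of the cell already bounds the regret, so any single arm will do.
  rcases le_or_gt u 1 with hu1 | hu1
  · exact ⟨{hne.some}, Finset.singleton_nonempty _, hx₀,
      fun μ _ n R c₀ _ hn hc₀ _ hR _ => hsmall n R c₀ hn hc₀ hu1 hR⟩
  have hm3 : (⌈u⌉₊ : ℝ) + 1 ≤ 3 * u := by linarith [Nat.ceil_lt_add_one hu]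
  have hmu : u ≤ (⌈u⌉₊ : ℝ) + 1 := by linarith [Nat.le_ceil u]
  have hcard' : √(s.card * 2 ^ e) ≤ 3 ^ d * τ := by
    have h1 : (s.card : ℝ) ≤ (3 * u) ^ d := by
      calc (s.card : ℝ) ≤ ((⌈u⌉₊ : ℝ) + 1) ^ d := by exact_mod_cast hcard
        _ ≤ _ := by gcongr
    have h3 : (1 : ℝ) ≤ 3 ^ d := one_le_pow₀ (by norm_num)
    calc √(s.card * 2 ^ e) ≤ √((3 * u) ^ d * 2 ^ e) := by gcongr
      _ = √(3 ^ d) * τ := by rw [mul_pow, mul_assoc, Real.sqrt_mul (by positivity), huN]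
      _ ≤ 3 ^ d * τ := by
        gcongr
        exact Real.sqrt_le_iff.2 ⟨by positivity, by nlinarith⟩
  rcases le_or_gt (s.card : ℝ) (2 ^ e) with hsN | hsN
  · refine ⟨s, hs, hsN, fun μ hμ n R c₀ hn0 hn hc₀ _ _ hR => ?_⟩
    obtain ⟨i, hi, hμi⟩ := hμ.exists_iSup_sub_le hL hs hnet
    push_cast at hμi
    calc R ≤ n * ((⨆ x, μ x) - μ i) + c₀ * √(s.card * 2 ^ e) := hR i hi
      _ ≤ 2 ^ e * (L * (√d * (h / (⌈u⌉₊ + 1)))) + c₀ * (3 ^ d * τ) := by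
        exact add_le_add ((mul_le_mul_of_nonneg_left hμi hn0).trans (by gcongr)) (by gcongr)
      _ = √d * (u / (⌈u⌉₊ + 1) * τ) + c₀ * (3 ^ d * τ) := by
        have : (2 : ℝ) ^ e * (L * (√d * (h / (⌈u⌉₊ + 1)))) =
          √d * (2 ^ e * (L * h)) / (⌈u⌉₊ + 1) := by ring
        rw [this, huM]; ring
      _ ≤ √d * (1 * τ) + c₀ * (3 ^ d * τ) := by
        gcongr
        exact (div_le_one (by positivity)).2 hmu
      _ = _ := by ring
  -- With more grid points than rounds, the trivial bound `N` is below `√(K * N)`, so one arm again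
  -- suffices.
  · refine ⟨{hne.some}, Finset.singleton_nonempty _, hx₀,
      fun μ _ n R c₀ _ hn hc₀ hR _ _ => ?_⟩
    calc R ≤ 2 ^ e := hR.trans hn
      _ = √(2 ^ e * 2 ^ e) := (Real.sqrt_mul_self (by positivity)).symm
      _ ≤ √(s.card * 2 ^ e) := by gcongr
      _ ≤ 3 ^ d * τ := hcard'
      _ ≤ c₀ * 3 ^ d * τ := by
        gcongr
        exact le_mul_of_one_le_left (by positivity) hc₀
      _ ≤ _ := by
        gcongr
        linarith [Real.sqrt_nonneg d]

/-- Bounds on the regret of each epoch add up to a bound of the same order. -/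
lemma sum_le_of_epoch_bounds {ρ : ℕ → ℝ} {a β : ℝ} (ha : 0 ≤ a) (hβ : 0 < β)
    (hρ : ∀ e n : ℕ, n ≤ 2 ^ e →
      ∑ j ∈ Finset.range n, ρ (2 ^ e - 1 + j) ≤ a * ((2 : ℝ) ^ e) ^ β) (T : ℕ) :
    ∑ t ∈ Finset.range T, ρ t ≤ a * ((2 : ℝ) ^ β / ((2 : ℝ) ^ β - 1)) * (T : ℝ) ^ β := by
  have hr : 1 < (2 : ℝ) ^ β := Real.one_lt_rpow one_lt_two hβ
  have hpow : ∀ e : ℕ, ((2 : ℝ) ^ e) ^ β = ((2 : ℝ) ^ β) ^ e := fun e => by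
    rw [← Real.rpow_natCast, ← Real.rpow_natCast, ← Real.rpow_mul zero_le_two,
      ← Real.rpow_mul zero_le_two, mul_comm]
  -- The horizon may cut the last epoch short; this is why `hρ` covers every initial segment of an
  -- epoch.
  have key : ∀ E T : ℕ, T ≤ 2 ^ E - 1 →
      ∑ t ∈ Finset.range T, ρ t ≤ ∑ e ∈ Finset.range E, a * ((2 : ℝ) ^ β) ^ e := by
    intro E
    induction E with
    | zero => intro T hT; simp at hT; simp [hT]
    | succ E ih =>
      intro T hT
      rw [Finset.sum_range_succ]
      rcases le_total T (2 ^ E - 1) with h | h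
      · have : 0 ≤ a * ((2 : ℝ) ^ β) ^ E := by positivity
        linarith [ih T h]
      · obtain ⟨n, rfl⟩ := Nat.exists_eq_add_of_le h
        have h1 := Nat.one_le_two_pow (n := E)
        rw [Finset.sum_range_add]
        have h2 := hρ E n (by rw [pow_succ] at hT; omega)
        rw [hpow] at h2
        linarith [ih _ le_rfl]
  rcases Nat.eq_zero_or_pos T with rfl | hT
  · simp [Real.zero_rpow hβ.ne']
  · have h1 := key (Nat.log 2 T + 1) T
      (Nat.le_sub_one_of_lt (Nat.lt_pow_succ_log_self one_lt_two T))
    have h2 : ((2 : ℝ) ^ β) ^ Nat.log 2 T ≤ (T : ℝ) ^ β := by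
      rw [← hpow]
      have : (2 : ℝ) ^ Nat.log 2 T ≤ T := by exact_mod_cast Nat.pow_log_le_self 2 hT.ne'
      gcongr
    have hr' : 0 < (2 : ℝ) ^ β - 1 := by linarith
    rw [← Finset.mul_sum, geom_sum_eq hr.ne'] at h1
    calc _ ≤ _ := h1
      _ ≤ a * (((2 : ℝ) ^ β) ^ (Nat.log 2 T + 1) / ((2 : ℝ) ^ β - 1)) := by
        gcongr
        linarith
      _ = a * ((2 : ℝ) ^ β / ((2 : ℝ) ^ β - 1)) * ((2 : ℝ) ^ β) ^ Nat.log 2 T := by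
        rw [pow_succ]; ring
      _ ≤ _ := by gcongr

end Grid

end

end LipschitzBandit

theorem mainTheorem7 (d : ℕ) (hd : 1 ≤ d) :
    ∃ c c' : ℝ, ∀ (L h : ℝ) (C : Set (EuclideanSpace ℝ (Fin d))),
      0 ≤ L → LipschitzBandit.IsCell d h C →
      ∃ π : LipschitzBandit.Policy C,
        ∀ (μ : C → ℝ) (ν : Kernel C ℝ) [IsMarkovKernel ν],
          LipschitzBandit.IsMeanReward L C μ → LipschitzBandit.IsRewardKernel μ ν →
          ∀ T : ℕ,
            Integrable (LipschitzBandit.totalReward T) (LipschitzBandit.runLaw π ν) ∧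
            LipschitzBandit.expectedRegret π ν μ T ≤
              c * (L * h) ^ ((d : ℝ) / ((d : ℝ) + 2)) *
                (T : ℝ) ^ (((d : ℝ) + 1) / ((d : ℝ) + 2)) + c' := by
  set β : ℝ := ((d : ℝ) + 1) / ((d : ℝ) + 2) with hβ
  set c₀ : ℝ := 33 * Real.exp (3 / 2) + 2 with hc₀
  have hc₀1 : 1 ≤ c₀ := by
    have := Real.exp_pos (3 / 2)
    linarith
  -- The first factor is the per-epoch constant and the second comes from the geometric series; the
  -- additive constant can be `0`.
  refine ⟨(√d + c₀ * 3 ^ d) * ((2 : ℝ) ^ β / ((2 : ℝ) ^ β - 1)), 0, fun L h C hL hC => ?_⟩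
  have hh := hC.pos hd
  choose arms hne hcard harms using fun e => hC.exists_arms hd hL e
  refine ⟨LipschitzBandit.epochPolicy hne hcard, fun μ ν _ hμ hν T => ?_⟩
  set P := LipschitzBandit.runLaw (LipschitzBandit.epochPolicy hne hcard) ν with hP
  have hne' : Nonempty C := ⟨(hne 0).choose⟩
  have hrew := fun c (hc : ∀ x, c ≤ μ x) t =>
    LipschitzBandit.integrable_reward_and_le hne hcard hν hμ.mem_Icc hc t
  have hint : ∀ t, Integrable (fun ω => (ω t).2) P := fun t =>
    (hrew 0 (fun x => (hμ.mem_Icc x).1) t).1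
  refine ⟨integrable_finsetSum _ fun t _ => hint t, ?_⟩
  set S := ⨆ x, μ x with hS
  have hS1 : S ≤ 1 := ciSup_le fun x => (hμ.mem_Icc x).2
  have hdiam : ∀ x, S - L * (√d * h) ≤ μ x := fun x => by
    rw [sub_le_iff_le_add]
    refine ciSup_le fun y => ?_
    have h1 := (le_abs_self _).trans (hμ.lipschitz y x)
    have h2 := mul_le_mul_of_nonneg_left (hC.norm_sub_le hd y x) hL
    linarith
  set ρ : ℕ → ℝ := fun t => S - ∫ ω, (ω t).2 ∂P with hρ
  have hreg : LipschitzBandit.expectedRegret (LipschitzBandit.epochPolicy hne hcard) ν μ T =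
      ∑ t ∈ Finset.range T, ρ t := by
    simp only [LipschitzBandit.expectedRegret, LipschitzBandit.totalReward, hρ]
    rw [integral_finsetSum _ fun t _ => hint t, Finset.sum_sub_distrib, Finset.sum_const,
      Finset.card_range, nsmul_eq_mul]
  rw [hreg, add_zero]
  have hsum := LipschitzBandit.sum_le_of_epoch_bounds (ρ := ρ) (β := β)
    (a := (√d + c₀ * 3 ^ d) * (L * h) ^ ((d : ℝ) / ((d : ℝ) + 2))) (by positivity) (by positivity)
    (fun e n hn => ?_) T
  · calc _ ≤ _ := hsum
      _ = _ := by ring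
  rw [mul_assoc]
  -- The three remaining goals are the regret bounds from the range of `μ`, from the diameter of the
  -- cell, and against a fixed arm of the epoch.
  refine harms e μ hμ n _ c₀ (by positivity) (by exact_mod_cast hn) hc₀1 ?_ ?_ fun i hi => ?_
  · calc _ ≤ ∑ _j ∈ Finset.range n, (1 : ℝ) := Finset.sum_le_sum fun j _ => by
          have := (hrew 0 (fun x => (hμ.mem_Icc x).1) (2 ^ e - 1 + j)).2
          simp only [hρ]; linarith
      _ = n := by simp
  · calc _ ≤ ∑ _j ∈ Finset.range n, L * (√d * h) := Finset.sum_le_sum fun j _ => by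
          have := (hrew _ hdiam (2 ^ e - 1 + j)).2
          simp only [hρ]; linarith
      _ = n * (L * (√d * h)) := by simp
  · have h1 := LipschitzBandit.sum_epoch_regret_le hne hcard hν hμ.mem_Icc hn hi
    simp only [hρ, Finset.sum_sub_distrib, Finset.sum_const, Finset.card_range, nsmul_eq_mul]
    linarith
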